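/- Let $d\ge 1$, let $\Omega\subset\mathbb R^d$ be open and bounded, and let $V$ be a real Banach space with dual $V^*$. Let $\|\cdot\|_{(V^*)^d}$ be a norm on $(V^*)^d$ such that for all $x\in\mathbb R^d$, $p=(p_1,\dots,p_d)\in (V^*)^d$, $q\in V^*$ and $v\in V$ $$\Big|\sum_{i=1}^d x_i\langle p_i,v\rangle\Big|\le \|x\|_2\,\|p\|_{(V^*)^d}\,\|v\|_V,\qquad \|(x_1q,\dots,x_dq)\|_{(V^*)^d}\le \|x\|_2\,\|q\|_{V^*}.$$ For $u\colon\Omega\to V$ define the total variation $$\operatorname{TV}_V(u):=\sup\Big\{\int_\Omega\langle-\operatorname{div}p(x),u(x)\rangle\,dx \;:\; p\in C_c^1(\Omega,(V^*)^d),\ \|p(x)\|_{(V^*)^d}\le 1\ \ \forall x\in\Omega\Big\},\qquad \operatorname{div}p:=\sum_{i=1}^d\partial_ip_i .$$ Let $U$ be a Lebesgue measurable set that is compactly contained in $\Omega$ (its closure is a compact subset of $\Omega$) and has $C^1$ boundary, i.e. for every $x\in\partial U$ there is a function $\varphi$ that is $C^1$ near $x$ with $\varphi(x)=0$ and $\nabla\varphi(x)\neq0$,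 such that in a neighbourhood of $x$ the set $U$ contains $\{\varphi<0\}$ and is disjoint from $\{\varphi>0\}$. Let $u^+,u^-\in V$, and let $u(x)=u^+$ for $x\in U$ and $u(x)=u^-$ for $x\in\Omega\setminus U$. Then $$\operatorname{TV}_V(u)=\mathcal H^{d-1}(\partial U)\cdot\|u^+-u^-\|_V,$$ where $\mathcal H^{d-1}$ is the $(d-1)$-dimensional Hausdorff measure, normalized to agree with Lebesgue measure on $\mathbb R^{d-1}$. -/

import Mathlib

open MeasureTheory Topology

noncomputable section

namespace CartoonTV

/-- `U ⊆ ℝ^d` has `C¹` boundary: near every boundary point `x` there is a `C¹` function `φ` with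
nonvanishing gradient at `x` such that, close to `x`, the set `U` lies on one side of the
hypersurface `{φ = 0}`: it contains `{φ < 0}` and is disjoint from `{φ > 0}`.
(By the implicit function theorem this is the usual description of `U` as the region below the
graph of a `C¹` function in suitable coordinates. As `U` need not be open, its boundary points may
or may not belong to `U`.) -/
def HasC1Boundary {d : ℕ} (U : Set (EuclideanSpace ℝ (Fin d))) : Prop :=
  ∀ x ∈ frontier U, ∃ φ : EuclideanSpace ℝ (Fin d) → ℝ,
    ContDiffAt ℝ 1 φ x ∧ φ x = 0 ∧ fderiv ℝ φ x ≠ 0 ∧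
      ∀ᶠ y in 𝓝 x, (φ y < 0 → y ∈ U) ∧ (0 < φ y → y ∉ U)

/-- `U` is compactly contained in `Ω`. -/
def CompactlyContained {X : Type*} [TopologicalSpace X] (U Ω : Set X) : Prop :=
  IsCompact (closure U) ∧ closure U ⊆ Ω

/-- The divergence `∑ i, ∂ᵢ pᵢ (x)` of a field `p` with values in `(V*)^d`. -/
def divergence {d : ℕ} {V : Type*} [NormedAddCommGroup V] [NormedSpace ℝ V]
    (p : EuclideanSpace ℝ (Fin d) → Fin d → StrongDual ℝ V) (x : EuclideanSpace ℝ (Fin d)) :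
    StrongDual ℝ V :=
  ∑ i, fderiv ℝ (fun y => p y i) x (EuclideanSpace.single i 1)

/-- The admissible dual fields: `p ∈ C_c¹(Ω, (V*)^d)`, extended by zero to `ℝ^d`, such that
`N (p x) ≤ 1` for all `x ∈ Ω`, where `N` is the chosen norm on `(V*)^d`. -/
structure IsAdmissible {d : ℕ} {V : Type*} [NormedAddCommGroup V] [NormedSpace ℝ V]
    (N : Seminorm ℝ (Fin d → StrongDual ℝ V)) (Ω : Set (EuclideanSpace ℝ (Fin d)))
    (p : EuclideanSpace ℝ (Fin d) → Fin d → StrongDual ℝ V) : Prop where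
  contDiff : ContDiff ℝ 1 p
  hasCompactSupport : HasCompactSupport p
  tsupport_subset : tsupport p ⊆ Ω
  norm_le : ∀ x ∈ Ω, N (p x) ≤ 1

/-- The total variation of `u : Ω → V` with respect to the norm `N` on `(V*)^d`, as an extended
real number. Only the values of `u` on `Ω` matter. -/
def totalVariation {d : ℕ} {V : Type*} [NormedAddCommGroup V] [NormedSpace ℝ V]
    (N : Seminorm ℝ (Fin d → StrongDual ℝ V)) (Ω : Set (EuclideanSpace ℝ (Fin d)))
    (u : EuclideanSpace ℝ (Fin d) → V) : EReal :=
  ⨆ (p : EuclideanSpace ℝ (Fin d) → Fin d → StrongDual ℝ V) (_ : IsAdmissible N Ω p),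
    ((∫ x in Ω, (-divergence p x) (u x) : ℝ) : EReal)

end CartoonTV

end

/-!
The total variation of the two-valued function `u` reduces to the perimeter of `U`: the constant
part of `u` integrates to zero against a divergence, so only the flux out of `U` of the vector
field `(⟨pᵢ, w⟩)ᵢ` remains, where `w = u⁺ - u⁻` is the jump (`integral_divergence_apply_eq`). The
lower bound on the norm of `(V*)^d` gives this field Euclidean norm at most `‖w‖`
(`norm_evalField_le`); the upper bound makes `-η ⊗ q` admissible for every vector field `η` with
`‖η‖ ≤ 1` and every functional `q` norming `w`. It remains to show that the supremum of
`∫_U div η` over such `η` is the Hausdorff measure of the boundary.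

Neither the Gauss-Green formula nor the area formula is needed for this. Near a boundary point, `U`
is the sublevel set `{φ < 0}` of a function whose differential is within `ε` of `⟪ν, ·⟫` for a fixed
unit vector `ν` (`IsAlmostFlat`, `HasC1Boundary.exists_isAlmostFlat`). For nonnegative `ψ` supported
there, Fubini in direction `ν` and the fundamental theorem of calculus on each line express
`∫_U ∂_ν ψ` as an integral over the projection of `{φ = 0}` to the hyperplane orthogonal to `ν`
(`IsAlmostFlat.setIntegral_fderiv_apply`). On `{φ = 0}` this projection is `1`-Lipschitz with an
almost `1`-Lipschitz inverse, so the integral agrees with that of `ψ` against the Hausdorff measure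
up to a factor close to `1` (`IsAlmostFlat.lintegral_zero_set`). Moreover, a field `η` with
`‖η‖ ≤ ψ` has essentially no more flux than `ψ ν`: approximating the indicator function of
`{φ < 0}` by `χₙ ∘ φ` with `χₙ` decreasing and integrating by parts, this becomes the pointwise
comparison of `Dφ η` with `ψ Dφ ν` (`IsAlmostFlat.abs_setIntegral_scalarDivergence_le`).

A finite partition of unity `ψᵢ` subordinate to such charts globalizes both facts: `∑ ψᵢ νᵢ` is an
admissible field whose flux is the Hausdorff measure of the boundary up to a factor `1 + δ`, and no
field of norm at most `1` does better up to the same factor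
(`HasC1Boundary.exists_almost_optimal_field`).
-/

noncomputable section

namespace CartoonTV

open Set Filter
open scoped NNReal ENNReal RealInnerProductSpace

section

/-! ### Integrals of derivatives -/

variable {E : Type*} [NormedAddCommGroup E] [InnerProductSpace ℝ E]

lemma continuous_fderiv_apply_const {h : E → ℝ} (hh : ContDiff ℝ 1 h) (a : E) :
    Continuous fun x => fderiv ℝ h x a :=
  (hh.continuous_fderiv one_ne_zero).clm_apply continuous_const

variable [FiniteDimensional ℝ E] [MeasurableSpace E] [BorelSpace E]

lemma integrable_fderiv_apply {h : E → ℝ} (hh : ContDiff ℝ 1 h) (hc : HasCompactSupport h)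
    (a : E) : Integrable fun x => fderiv ℝ h x a :=
  (continuous_fderiv_apply_const hh a).integrable_of_hasCompactSupport (hc.fderiv_apply ℝ a)

lemma integral_fderiv_apply_eq_zero {h : E → ℝ} (hh : ContDiff ℝ 1 h)
    (hc : HasCompactSupport h) (a : E) : ∫ x, fderiv ℝ h x a = 0 := by
  have := integral_mul_fderiv_eq_neg_fderiv_mul_of_integrable (μ := volume)
    (f := fun _ : E => (1 : ℝ)) (g := h) (v := a) (by simp)
    (by simpa using integrable_fderiv_apply hh hc a)
    (by simpa using hh.continuous.integrable_of_hasCompactSupport hc)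
    (by simp) (fun x _ => hh.differentiable one_ne_zero x)
  simpa using this

/-- Integration by parts against `χ ∘ φ`. -/
lemma integral_comp_mul_fderiv {χ : ℝ → ℝ} {φ h : E → ℝ} (hχ : ContDiff ℝ 1 χ)
    (hφ : ContDiff ℝ 1 φ) (hh : ContDiff ℝ 1 h) (hc : HasCompactSupport h) (a : E) :
    ∫ x, χ (φ x) * fderiv ℝ h x a = -∫ x, deriv χ (φ x) * fderiv ℝ φ x a * h x := by
  have hχφ : ContDiff ℝ 1 fun x => χ (φ x) := hχ.comp hφ
  have hd : ∀ x, fderiv ℝ (fun x => χ (φ x)) x a = deriv χ (φ x) * fderiv ℝ φ x a := by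
    intro x
    have h1 := ((hχ.differentiable one_ne_zero (φ x)).hasDerivAt).comp_hasFDerivAt x
      (hφ.differentiable one_ne_zero x).hasFDerivAt
    have h2 : fderiv ℝ (fun x => χ (φ x)) x = deriv χ (φ x) • fderiv ℝ φ x := h1.fderiv
    simp [h2]
  have := integral_mul_fderiv_eq_neg_fderiv_mul_of_integrable (μ := volume)
    (f := fun x => χ (φ x)) (g := h) (v := a)
    (((continuous_fderiv_apply_const hχφ a).mul
      hh.continuous).integrable_of_hasCompactSupport hc.mul_left)
    ((hχφ.continuous.mul (continuous_fderiv_apply_const hh a)).integrable_of_hasCompactSupport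
      (hc.fderiv_apply ℝ a).mul_left)
    ((hχφ.continuous.mul hh.continuous).integrable_of_hasCompactSupport hc.mul_left)
    (fun x _ => hχφ.differentiable one_ne_zero x) (fun x _ => hh.differentiable one_ne_zero x)
  rw [this]
  simp_rw [hd]

/-- If the support of `h` avoids the boundary of `U`, then cutting `h` off outside `U` leaves a
`C¹` function, and so the derivatives of `h` integrate to zero over `U`. -/
lemma setIntegral_fderiv_eq_zero_of_disjoint_frontier {U : Set E}
    (hU : NullMeasurableSet U) {h : E → ℝ} (hh : ContDiff ℝ 1 h) (hc : HasCompactSupport h)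
    (hd : Disjoint (tsupport h) (frontier U)) (a : E) :
    ∫ x in U, fderiv ℝ h x a = 0 := by
  have key : ∀ x, (U.indicator h =ᶠ[𝓝 x] h ∧ x ∈ U) ∨ (U.indicator h =ᶠ[𝓝 x] 0 ∧ x ∉ U) ∨
      (U.indicator h =ᶠ[𝓝 x] 0 ∧ h =ᶠ[𝓝 x] 0) := by
    intro x
    by_cases hx : x ∈ tsupport h
    · have hxf : x ∉ frontier U := disjoint_left.1 hd hx
      by_cases hxU : x ∈ U
      · left
        have : x ∈ interior U := by
          by_contra hcon
          exact hxf ⟨subset_closure hxU, hcon⟩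
        refine ⟨?_, hxU⟩
        filter_upwards [mem_interior_iff_mem_nhds.1 this] with y hy
        simp [hy]
      · right; left
        have : x ∉ closure U := by
          intro hcon
          exact hxf ⟨hcon, fun h' => hxU (interior_subset h')⟩
        refine ⟨?_, hxU⟩
        filter_upwards [isClosed_closure.isOpen_compl.mem_nhds this] with y hy
        simp [show y ∉ U from fun h' => hy (subset_closure h')]
    · right; right
      have h0 := notMem_tsupport_iff_eventuallyEq.1 hx
      refine ⟨?_, h0⟩
      filter_upwards [h0] with y hy
      by_cases hyU : y ∈ U <;> simp [hyU, hy]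
  have hcd : ContDiff ℝ 1 (U.indicator h) := by
    rw [contDiff_iff_contDiffAt]
    intro x
    rcases key x with ⟨h1, -⟩ | ⟨h1, -⟩ | ⟨h1, -⟩
    · exact hh.contDiffAt.congr_of_eventuallyEq h1
    · exact contDiffAt_const.congr_of_eventuallyEq h1
    · exact contDiffAt_const.congr_of_eventuallyEq h1
  have hcs : HasCompactSupport (U.indicator h) :=
    hc.mono (fun x hx => by
      simp only [Function.mem_support, ne_eq, indicator_apply_eq_zero, not_forall] at hx
      exact hx.2)
  rw [← integral_indicator₀ hU, ← integral_fderiv_apply_eq_zero hcd hcs a]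
  congr 1
  ext x
  rcases key x with ⟨h1, h2⟩ | ⟨h1, h2⟩ | ⟨h1, h2⟩
  · rw [h1.fderiv_eq]; simp [h2]
  · rw [h1.fderiv_eq]; simp [h2]
  · have h3 : fderiv ℝ h x = 0 := by rw [h2.fderiv_eq]; simp
    rw [h1.fderiv_eq]
    by_cases hxU : x ∈ U <;> simp [hxU, h3]

/-- In one variable: integrating `f'` over `{θ < 0}`, where `θ` is strictly increasing on an
interval containing the support of `f`, gives the value of `f` at the zero of `θ`. -/
lemma setIntegral_deriv_sublevel {f θ : ℝ → ℝ} {I : Set ℝ} (hf : ContDiff ℝ 1 f)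
    (hfc : HasCompactSupport f) (hfI : tsupport f ⊆ I) (hθ : Continuous θ)
    (hmono : StrictMonoOn θ I) {z : ℝ} (hz : z ∈ I) (hz0 : θ z = 0) :
    ∫ t in {t | θ t < 0}, deriv f t = f z := by
  rw [← hfc.integral_Iic_deriv_eq hf z, integral_Iic_eq_integral_Iio,
    ← integral_indicator (measurableSet_lt hθ.measurable measurable_const),
    ← integral_indicator measurableSet_Iio]
  congr 1
  ext t
  by_cases ht : t ∈ I
  · have : t ∈ {t | θ t < 0} ↔ t ∈ Iio z := by
      rw [mem_ofPred_eq, mem_Iio, ← hmono.lt_iff_lt ht hz, hz0]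
    by_cases htz : t ∈ Iio z
    · rw [indicator_of_mem htz, indicator_of_mem (this.2 htz)]
    · rw [indicator_of_notMem htz, indicator_of_notMem (fun h => htz (this.1 h))]
  · have h0 : deriv f t = 0 := by
      have := notMem_tsupport_iff_eventuallyEq.1 (fun h => ht (hfI h))
      rw [this.deriv_eq]; simp
    simp [indicator, h0]

lemma setIntegral_deriv_sublevel_of_ne_zero {f θ : ℝ → ℝ} {I : Set ℝ} (hf : ContDiff ℝ 1 f)
    (hfc : HasCompactSupport f) (hI : I.OrdConnected) (hfI : tsupport f ⊆ I) (hθ : Continuous θ)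
    (hne : ∀ z ∈ I, θ z ≠ 0) :
    ∫ t in {t | θ t < 0}, deriv f t = 0 := by
  have h0 : ∀ t ∉ I, deriv f t = 0 := fun t ht => by
    have := notMem_tsupport_iff_eventuallyEq.1 (fun h => ht (hfI h))
    rw [this.deriv_eq]; simp
  have hall : (∀ t ∈ I, θ t < 0) ∨ ∀ t ∈ I, ¬ θ t < 0 := by
    by_contra! hcon
    obtain ⟨⟨s, hs, hs0⟩, t, ht, ht0⟩ := hcon
    obtain ⟨z, hz, hz0⟩ := hI.isPreconnected.intermediate_value ht hs hθ.continuousOn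
      ⟨ht0.le, hs0⟩
    exact hne z hz hz0
  rw [← integral_indicator (measurableSet_lt hθ.measurable measurable_const)]
  rcases hall with hall | hall
  · rw [show indicator {t | θ t < 0} (deriv f) = deriv f from ?_]
    · rw [integral_eq_zero_of_hasDerivAt_of_integrable
        (fun t => (hf.differentiable one_ne_zero t).hasDerivAt)
        ((hf.continuous_deriv le_rfl).integrable_of_hasCompactSupport hfc.deriv)
        (hf.continuous.integrable_of_hasCompactSupport hfc)]
    · ext t
      by_cases ht : t ∈ I
      · simp [indicator, hall t ht]
      · simp [indicator, h0 t ht]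
  · rw [show indicator {t | θ t < 0} (deriv f) = 0 from ?_]
    · simp
    · ext t
      by_cases ht : t ∈ I
      · simp [indicator, hall t ht]
      · simp [indicator, h0 t ht]

/-! ### Fubini along a direction -/

lemma measurePreserving_smul_add {ν : E} (hν : ‖ν‖ = 1) :
    MeasurePreserving (fun p : ℝ × (ℝ ∙ ν)ᗮ => p.1 • ν + (p.2 : E))
      (volume.prod volume) volume := by
  have h1 := ((ℝ ∙ ν).measurePreserving_measurableEquivProd (0 : E)).symm
  rw [InnerProductSpace.euclideanHausdorffMeasure_eq_volume] at h1
  have h2 : MeasurePreserving (Prod.map (LinearIsometryEquiv.toSpanUnitSingleton (𝕜 := ℝ) ν hν)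
      (id : (ℝ ∙ ν)ᗮ → (ℝ ∙ ν)ᗮ)) (volume.prod volume) (volume.prod volume) :=
    (LinearIsometryEquiv.toSpanUnitSingleton (𝕜 := ℝ) ν hν).measurePreserving.prod
      (MeasurePreserving.id _)
  convert! h1.comp h2 using 1
  ext p
  simp

lemma integral_eq_integral_integral_line {ν : E} (hν : ‖ν‖ = 1) {k : E → ℝ}
    (hk : Integrable k) :
    ∫ x, k x = ∫ y : (ℝ ∙ ν)ᗮ, ∫ t : ℝ, k (t • ν + y) := by
  have hmp := measurePreserving_smul_add hν
  have hk' : AEStronglyMeasurable k (Measure.map (fun p : ℝ × (ℝ ∙ ν)ᗮ => p.1 • ν + (p.2 : E))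
      (volume.prod volume)) := by rw [hmp.map_eq]; exact hk.1
  conv_lhs => rw [← hmp.map_eq]
  rw [integral_map hmp.measurable.aemeasurable hk', integral_prod_symm]
  exact hmp.integrable_comp_of_integrable hk

/-- A measurable set that meets each line of direction `ν` at most once is null. -/
lemma volume_eq_zero_of_subsingleton_lines {ν : E} (hν : ‖ν‖ = 1) {S : Set E}
    (hS : MeasurableSet S)
    (h : ∀ y : (ℝ ∙ ν)ᗮ, {t : ℝ | t • ν + (y : E) ∈ S}.Subsingleton) : volume S = 0 := by
  have hmp := measurePreserving_smul_add hν
  rw [← hmp.measure_preimage hS.nullMeasurableSet,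
    Measure.prod_apply_symm (hmp.measurable hS)]
  simp only [preimage_preimage]
  refine (lintegral_congr fun y => ?_).trans lintegral_zero
  exact (h y).measure_zero volume

end

section

/-! ### Comparison of Hausdorff measure with the measure of a projection -/

lemma euclideanHausdorffMeasure_image_le {X Y : Type*} [EMetricSpace X] [MeasurableSpace X]
    [BorelSpace X] [EMetricSpace Y] [MeasurableSpace Y] [BorelSpace Y] {K : ℝ≥0} {f : X → Y}
    {s : Set X} (h : LipschitzOnWith K f s) (n : ℕ) :
    μHE[n] (f '' s) ≤ (K : ℝ≥0∞) ^ n * μHE[n] s := by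
  simp only [Measure.euclideanHausdorffMeasure_def, Measure.smul_apply, ENNReal.smul_def,
    smul_eq_mul]
  have := h.hausdorffMeasure_image_le (d := n) (by positivity)
  rw [ENNReal.rpow_natCast] at this
  calc _ ≤ _ * ((K : ℝ≥0∞) ^ n * μH[n] s) := by gcongr
    _ = _ := by ring

/-- If `π` is a 1-Lipschitz map onto an `n`-dimensional space whose restriction to the compact set
`S` has a `K`-Lipschitz inverse `s`, then integrals over `S` against the `n`-dimensional Hausdorff
measure and integrals over the parameter domain `π '' S` agree up to the factor `K ^ n`. -/
lemma lintegral_section_le {E F : Type*} [MetricSpace E] [MeasurableSpace E]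
    [BorelSpace E] [NormedAddCommGroup F] [InnerProductSpace ℝ F] [FiniteDimensional ℝ F]
    [MeasurableSpace F] [BorelSpace F] {π : E → F} {s : F → E} {S : Set E} {K : ℝ≥0}
    (hS : IsCompact S) (hπ : LipschitzWith 1 π) (hs : ∀ x ∈ S, s (π x) = x)
    (hsK : LipschitzOnWith K s (π '' S)) {f : E → ℝ≥0∞} (hf : Measurable f) :
    ∫⁻ y in π '' S, f (s y) ≤ ∫⁻ x in S, f x ∂μHE[Module.finrank ℝ F] ∧
    ∫⁻ x in S, f x ∂μHE[Module.finrank ℝ F] ≤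
      (K : ℝ≥0∞) ^ Module.finrank ℝ F * ∫⁻ y in π '' S, f (s y) := by
  set n := Module.finrank ℝ F
  have hT : MeasurableSet (π '' S) := (hS.image hπ.continuous).measurableSet
  have hsm : AEMeasurable s (volume.restrict (π '' S)) := by
    exact hsK.continuousOn.aemeasurable hT
  set m : Measure E := Measure.map s (volume.restrict (π '' S)) with hm
  have hlin : ∫⁻ y in π '' S, f (s y) = ∫⁻ x, f x ∂m := (lintegral_map' hf.aemeasurable hsm).symm
  have hmA : ∀ A, MeasurableSet A → m A = μHE[n] (π '' (S ∩ A)) := by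
    intro A hA
    rw [hm, Measure.map_apply_of_aemeasurable hsm hA, Measure.restrict_apply' hT,
      ← InnerProductSpace.euclideanHausdorffMeasure_eq_volume]
    congr 1
    ext y
    constructor
    · rintro ⟨hy, x, hx, rfl⟩
      rw [mem_preimage, hs x hx] at hy
      exact ⟨x, ⟨hx, hy⟩, rfl⟩
    · rintro ⟨x, ⟨hx, hxA⟩, rfl⟩
      exact ⟨by rwa [mem_preimage, hs x hx], x, hx, rfl⟩
  have h1 : m ≤ (μHE[n] : Measure E).restrict S := by
    refine Measure.le_iff.2 fun A hA => ?_
    rw [hmA A hA, Measure.restrict_apply hA, inter_comm A]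
    simpa using euclideanHausdorffMeasure_image_le (hπ.lipschitzOnWith (s := S ∩ A)) n
  have h2 : (μHE[n] : Measure E).restrict S ≤ (K : ℝ≥0∞) ^ n • m := by
    refine Measure.le_iff.2 fun A hA => ?_
    rw [Measure.smul_apply, hmA A hA, Measure.restrict_apply hA, inter_comm A, smul_eq_mul]
    have h3 : s '' (π '' (S ∩ A)) = S ∩ A := by
      rw [image_image]
      exact (image_congr fun x hx => hs x hx.1).trans (image_id' _)
    have := euclideanHausdorffMeasure_image_le
      (hsK.mono (image_mono (inter_subset_left (s := S) (t := A)))) n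
    rwa [h3] at this
  rw [hlin]
  refine ⟨lintegral_mono' h1 le_rfl, (lintegral_mono' h2 le_rfl).trans ?_⟩
  rw [lintegral_smul_measure, smul_eq_mul]

/-! ### Almost flat charts -/

variable {E : Type*} [NormedAddCommGroup E] [InnerProductSpace ℝ E]

lemma eq_inner_smul_add_proj {ν : E} (hν : ‖ν‖ = 1) (z : E) :
    z = ⟪ν, z⟫ • ν + ((ℝ ∙ ν)ᗮ.orthogonalProjectionOnto z : E) := by
  conv_lhs => rw [← (ℝ ∙ ν).starProjection_add_starProjection_orthogonal z]
  rw [Submodule.starProjection_unit_singleton ℝ hν]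
  rfl

/-- The level function `φ` is almost flat on the ball `B(x₀, r)`: its differential is within `ε`
of the inner product with the unit vector `ν`. -/
structure IsAlmostFlat (ε : ℝ) (ν : E) (φ : E → ℝ) (x₀ : E) (r : ℝ) : Prop where
  contDiff : ContDiff ℝ 1 φ
  norm_eq_one : ‖ν‖ = 1
  pos : 0 < ε
  lt_one : ε < 1
  fderiv_close : ∀ x ∈ Metric.ball x₀ r, ‖fderiv ℝ φ x - innerSL ℝ ν‖ ≤ ε

namespace IsAlmostFlat

variable {ε : ℝ} {ν : E} {φ : E → ℝ} {x₀ : E} {r : ℝ}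

lemma abs_sub_sub_inner_le (H : IsAlmostFlat ε ν φ x₀ r) {x y : E} (hx : x ∈ Metric.ball x₀ r)
    (hy : y ∈ Metric.ball x₀ r) : |φ x - φ y - ⟪ν, x - y⟫| ≤ ε * ‖x - y‖ := by
  have := (convex_ball x₀ r).norm_image_sub_le_of_norm_fderiv_le' (f := φ)
    (fun z _ => H.contDiff.differentiable one_ne_zero z) H.fderiv_close hy hx
  simpa using this

lemma abs_fderiv_apply_sub_inner_le (H : IsAlmostFlat ε ν φ x₀ r) {x : E}
    (hx : x ∈ Metric.ball x₀ r) (a : E) : |fderiv ℝ φ x a - ⟪ν, a⟫| ≤ ε * ‖a‖ := by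
  have := (fderiv ℝ φ x - innerSL ℝ ν).le_of_opNorm_le (H.fderiv_close x hx) a
  simpa using this

lemma one_sub_le_fderiv_apply (H : IsAlmostFlat ε ν φ x₀ r) {x : E}
    (hx : x ∈ Metric.ball x₀ r) : 1 - ε ≤ fderiv ℝ φ x ν := by
  have := abs_le.1 (H.abs_fderiv_apply_sub_inner_le hx ν)
  rw [real_inner_self_eq_norm_sq, H.norm_eq_one] at this
  linarith

lemma abs_fderiv_apply_le (H : IsAlmostFlat ε ν φ x₀ r) {x : E}
    (hx : x ∈ Metric.ball x₀ r) (a : E) : |fderiv ℝ φ x a| ≤ (1 + ε) * ‖a‖ := by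
  have h1 := H.abs_fderiv_apply_sub_inner_le hx a
  have h2 := abs_real_inner_le_norm ν a
  rw [H.norm_eq_one] at h2
  have h3 := abs_sub_abs_le_abs_sub (fderiv ℝ φ x a) ⟪ν, a⟫
  linarith

lemma strictMonoOn_line (H : IsAlmostFlat ε ν φ x₀ r) (y : E) :
    StrictMonoOn (fun t : ℝ => φ (t • ν + y)) {t : ℝ | t • ν + y ∈ Metric.ball x₀ r} := by
  intro s hs t ht hst
  have h := abs_le.1 (H.abs_sub_sub_inner_le ht hs)
  have h1 : t • ν + y - (s • ν + y) = (t - s) • ν := by module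
  rw [h1, inner_smul_right, real_inner_self_eq_norm_sq, norm_smul, H.norm_eq_one,
    Real.norm_of_nonneg (by linarith)] at h
  have := mul_pos (sub_pos.2 hst) (sub_pos.2 H.lt_one)
  change φ (s • ν + y) < φ (t • ν + y)
  linarith

lemma norm_sub_le_norm_proj (H : IsAlmostFlat ε ν φ x₀ r) {x y : E} (hx : x ∈ Metric.ball x₀ r)
    (hy : y ∈ Metric.ball x₀ r) (hxy : φ x = φ y) :
    (1 - ε) * ‖x - y‖ ≤
      ‖(ℝ ∙ ν)ᗮ.orthogonalProjectionOnto x - (ℝ ∙ ν)ᗮ.orthogonalProjectionOnto y‖ := by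
  have h := H.abs_sub_sub_inner_le hx hy
  rw [hxy, sub_self, zero_sub, abs_neg] at h
  rw [← map_sub]
  set z := x - y
  have h2 := eq_inner_smul_add_proj H.norm_eq_one z
  have h3 : ‖z‖ ≤ ‖⟪ν, z⟫ • ν‖ + ‖((ℝ ∙ ν)ᗮ.orthogonalProjectionOnto z : E)‖ := by
    conv_lhs => rw [h2]
    exact norm_add_le _ _
  rw [norm_smul, H.norm_eq_one, mul_one, Real.norm_eq_abs] at h3
  have h4 : ‖((ℝ ∙ ν)ᗮ.orthogonalProjectionOnto z : E)‖ =
      ‖(ℝ ∙ ν)ᗮ.orthogonalProjectionOnto z‖ := rfl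
  linarith



lemma hasCompactSupport_of_tsupport_subset_ball [FiniteDimensional ℝ E] {ψ : E → ℝ}
    (hψ : tsupport ψ ⊆ Metric.ball x₀ r) : HasCompactSupport ψ :=
  Metric.isCompact_of_isClosed_isBounded (isClosed_tsupport ψ)
    (Metric.isBounded_ball.subset hψ)

/-- Since `φ` is strictly increasing in direction `ν`, it takes both signs near each of its zeros,
so that every zero is a boundary point of `U`. -/
lemma mem_frontier_iff (H : IsAlmostFlat ε ν φ x₀ r) {U : Set E}
    (hU : ∀ x ∈ Metric.ball x₀ r, (φ x < 0 → x ∈ U) ∧ (0 < φ x → x ∉ U)) {x : E}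
    (hx : x ∈ Metric.ball x₀ r) : x ∈ frontier U ↔ φ x = 0 := by
  have hBx := Metric.isOpen_ball.mem_nhds hx
  have hφ := H.contDiff.continuous
  constructor
  · intro hxU
    by_contra hne
    rcases Ne.lt_or_gt hne with h | h
    · refine hxU.2 (mem_interior_iff_mem_nhds.2 ?_)
      filter_upwards [hBx, (isOpen_lt hφ continuous_const).mem_nhds h] with y hy hy0
      exact (hU y hy).1 hy0
    · rw [frontier_eq_closure_inter_closure] at hxU
      obtain ⟨y, ⟨hyB, hy0⟩, hyU⟩ := mem_closure_iff_nhds.1 hxU.1 _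
        (inter_mem hBx ((isOpen_lt continuous_const hφ).mem_nhds h))
      exact (hU y hyB).2 hy0 hyU
  · intro h0
    have hline : Tendsto (fun t : ℝ => t • ν + x) (𝓝 0) (𝓝 x) := by
      have : Continuous fun t : ℝ => t • ν + x := by fun_prop
      simpa using this.tendsto 0
    have hB0 : (0 : ℝ) • ν + x ∈ Metric.ball x₀ r := by simpa using hx
    have hev : ∀ᶠ t : ℝ in 𝓝 0, t • ν + x ∈ Metric.ball x₀ r := hline hBx
    rw [frontier_eq_closure_inter_closure]
    constructor
    · refine mem_closure_of_tendsto (hline.mono_left (nhdsWithin_le_nhds (s := Iio 0))) ?_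
      filter_upwards [hev.filter_mono nhdsWithin_le_nhds, self_mem_nhdsWithin] with t ht ht0
      refine (hU _ ht).1 ?_
      have := H.strictMonoOn_line x ht hB0 ht0
      simpa [h0] using this
    · refine mem_closure_of_tendsto (hline.mono_left (nhdsWithin_le_nhds (s := Ioi 0))) ?_
      filter_upwards [hev.filter_mono nhdsWithin_le_nhds, self_mem_nhdsWithin] with t ht ht0
      refine (hU _ ht).2 ?_
      have := H.strictMonoOn_line x hB0 ht ht0
      simpa [h0] using this

variable [FiniteDimensional ℝ E] [MeasurableSpace E] [BorelSpace E]

/-- The zero set of an almost flat function is a Lipschitz graph over the hyperplane `νᗮ`, and the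
derivative of `ψ` in direction `ν`, integrated over the sublevel set, gives the integral of `ψ`
over that graph with respect to the Lebesgue measure of the hyperplane. -/
lemma setIntegral_fderiv_apply (H : IsAlmostFlat ε ν φ x₀ r) {ψ : E → ℝ} (hψ : ContDiff ℝ 1 ψ)
    (hsupp : tsupport ψ ⊆ Metric.ball x₀ r) {s : (ℝ ∙ ν)ᗮ → E}
    (hs : ∀ x ∈ tsupport ψ ∩ {x | φ x = 0}, s ((ℝ ∙ ν)ᗮ.orthogonalProjectionOnto x) = x) :
    ∫ x in {x | φ x < 0}, fderiv ℝ ψ x ν =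
      ∫ y in (ℝ ∙ ν)ᗮ.orthogonalProjectionOnto '' (tsupport ψ ∩ {x | φ x = 0}), ψ (s y) := by
  have hc : HasCompactSupport ψ := hasCompactSupport_of_tsupport_subset_ball hsupp
  have hφc : Continuous φ := H.contDiff.continuous
  have hneg : MeasurableSet {x | φ x < 0} := (isOpen_lt hφc continuous_const).measurableSet
  have hS : IsCompact (tsupport ψ ∩ {x | φ x = 0}) :=
    IsCompact.inter_right hc (isClosed_eq hφc continuous_const)
  have hT : MeasurableSet ((ℝ ∙ ν)ᗮ.orthogonalProjectionOnto '' (tsupport ψ ∩ {x | φ x = 0})) :=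
    (hS.image (ContinuousLinearMap.continuous _)).measurableSet
  have hπ : ∀ (t : ℝ) (y : (ℝ ∙ ν)ᗮ),
      (ℝ ∙ ν)ᗮ.orthogonalProjectionOnto (t • ν + (y : E)) = y := by
    intro t y
    have h1 : (ℝ ∙ ν)ᗮ.orthogonalProjectionOnto ν = 0 := by
      apply Submodule.orthogonalProjectionOnto_apply_of_mem_orthogonal
      exact Submodule.le_orthogonal_orthogonal _ (Submodule.mem_span_singleton_self ν)
    rw [map_add, map_smul, h1, smul_zero, zero_add,
      Submodule.orthogonalProjectionOnto_mem_subspace_eq_self]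
  rw [← integral_indicator hneg, ← integral_indicator hT,
    integral_eq_integral_integral_line H.norm_eq_one
      ((integrable_fderiv_apply hψ hc ν).indicator hneg)]
  congr 1
  ext y
  -- the restrictions of `ψ` and `φ` to the line of direction `ν` through `y`
  have hline : ContDiff ℝ 1 fun t : ℝ => t • ν + (y : E) := by fun_prop
  set f : ℝ → ℝ := fun t => ψ (t • ν + y)
  set θ : ℝ → ℝ := fun t => φ (t • ν + y) with hθ
  set I : Set ℝ := {t | t • ν + (y : E) ∈ Metric.ball x₀ r}
  have hfd : ContDiff ℝ 1 f := hψ.comp hline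
  have hfs : tsupport f ⊆ {t | t • ν + (y : E) ∈ tsupport ψ} := by
    refine closure_minimal ?_ ((isClosed_tsupport ψ).preimage hline.continuous)
    intro t ht
    exact subset_tsupport ψ ht
  have hfc : HasCompactSupport f := by
    refine hc.comp_isClosedEmbedding (g := fun t : ℝ => t • ν + (y : E)) ?_
    refine Isometry.isClosedEmbedding (Isometry.of_dist_eq fun a b => ?_)
    rw [dist_add_right, dist_eq_norm, ← sub_smul, norm_smul, H.norm_eq_one, mul_one,
      dist_eq_norm]
  have hIc : I.OrdConnected := by
    have : Convex ℝ I := ((convex_ball x₀ r).translate_preimage_left (y : E)).linear_preimage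
      (LinearMap.toSpanSingleton ℝ E ν)
    exact this.ordConnected
  have hmono : StrictMonoOn θ I := H.strictMonoOn_line y
  have hθc : Continuous θ := hφc.comp hline.continuous
  have hderiv : ∀ t, deriv f t = fderiv ℝ ψ (t • ν + y) ν := by
    intro t
    have h1 : HasDerivAt (fun t : ℝ => t • ν + (y : E)) ν t := by
      simpa using ((hasDerivAt_id t).smul_const ν).add_const (y : E)
    exact ((hψ.differentiable one_ne_zero _).hasFDerivAt.comp_hasDerivAt t h1).deriv
  have hlhs : ∫ t : ℝ, indicator {x | φ x < 0} (fun x => fderiv ℝ ψ x ν) (t • ν + y) =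
      ∫ t in {t | θ t < 0}, deriv f t := by
    rw [← integral_indicator (measurableSet_lt hθc.measurable measurable_const)]
    congr 1
    ext t
    simp only [indicator, mem_ofPred_eq, hderiv, hθ]
  rw [hlhs]
  have hxline : ∀ x, (ℝ ∙ ν)ᗮ.orthogonalProjectionOnto x = y → x = ⟪ν, x⟫ • ν + (y : E) := by
    rintro x rfl
    exact eq_inner_smul_add_proj H.norm_eq_one x
  by_cases hz : ∃ z ∈ I, θ z = 0
  · obtain ⟨z, hzI, hz0⟩ := hz
    rw [setIntegral_deriv_sublevel hfd hfc (hfs.trans fun t ht => hsupp ht) hθc hmono hzI hz0]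
    by_cases hzs : z • ν + (y : E) ∈ tsupport ψ
    · have hmem : z • ν + (y : E) ∈ tsupport ψ ∩ {x | φ x = 0} := ⟨hzs, hz0⟩
      have h1 := hs _ hmem
      rw [hπ] at h1
      rw [indicator_of_mem (show y ∈ _ '' _ from ⟨_, hmem, hπ z y⟩), h1]
    · rw [indicator_of_notMem]
      · exact image_eq_zero_of_notMem_tsupport (f := ψ) hzs
      · rintro ⟨x, ⟨hx, hx0⟩, hxy⟩
        have hx' := hxline x hxy
        rw [hx'] at hx hx0
        rw [hmono.injOn (hsupp hx) hzI ((show θ _ = 0 from hx0).trans hz0.symm)] at hx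
        exact hzs hx
  · push Not at hz
    rw [setIntegral_deriv_sublevel_of_ne_zero hfd hfc hIc (hfs.trans fun t ht => hsupp ht) hθc hz,
      indicator_of_notMem]
    rintro ⟨x, ⟨hx, hx0⟩, hxy⟩
    have hx' := hxline x hxy
    rw [hx'] at hx hx0
    exact hz _ (hsupp hx) hx0

end IsAlmostFlat

end

namespace IsAlmostFlat

/-! ### The surface measure of an almost flat piece -/

section Surface

variable {E : Type*} [NormedAddCommGroup E] [InnerProductSpace ℝ E]
  {ε : ℝ} {ν : E} {φ : E → ℝ} {x₀ : E} {r : ℝ}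
  [FiniteDimensional ℝ E] [MeasurableSpace E] [BorelSpace E]

/-- For nonnegative `ψ` supported in the chart, the integral of the normal derivative of `ψ` over
the sublevel set is the integral of `ψ` over the level set, up to a factor close to `1`. -/
lemma lintegral_zero_set (H : IsAlmostFlat ε ν φ x₀ r) {ψ : E → ℝ} (hψ : ContDiff ℝ 1 ψ)
    (hsupp : tsupport ψ ⊆ Metric.ball x₀ r) (h0 : ∀ x, 0 ≤ ψ x) :
    ENNReal.ofReal (∫ x in {x | φ x < 0}, fderiv ℝ ψ x ν) ≤
      ∫⁻ x in tsupport ψ ∩ {x | φ x = 0},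
        ENNReal.ofReal (ψ x) ∂μHE[Module.finrank ℝ (ℝ ∙ ν)ᗮ] ∧
    ∫⁻ x in tsupport ψ ∩ {x | φ x = 0},
        ENNReal.ofReal (ψ x) ∂μHE[Module.finrank ℝ (ℝ ∙ ν)ᗮ] ≤
      ENNReal.ofReal ((1 - ε)⁻¹ ^ Module.finrank ℝ (ℝ ∙ ν)ᗮ *
        ∫ x in {x | φ x < 0}, fderiv ℝ ψ x ν) := by
  have hc : HasCompactSupport ψ := hasCompactSupport_of_tsupport_subset_ball hsupp
  set S := tsupport ψ ∩ {x | φ x = 0}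
  set π : E → (ℝ ∙ ν)ᗮ := (ℝ ∙ ν)ᗮ.orthogonalProjectionOnto
  have hS : IsCompact S :=
    IsCompact.inter_right hc (isClosed_eq H.contDiff.continuous continuous_const)
  have hε : 0 < 1 - ε := sub_pos.2 H.lt_one
  have hdist : ∀ x ∈ S, ∀ y ∈ S, ‖x - y‖ ≤ (1 - ε)⁻¹ * ‖π x - π y‖ := fun x hx y hy => by
    rw [inv_mul_eq_div, le_div_iff₀' hε]
    exact H.norm_sub_le_norm_proj (hsupp hx.1) (hsupp hy.1) (hx.2.trans hy.2.symm)
  have hinj : InjOn π S := fun x hx y hy hxy => by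
    have := hdist x hx y hy
    rw [hxy, sub_self, norm_zero, mul_zero] at this
    exact sub_eq_zero.1 (norm_le_zero_iff.1 this)
  -- the inverse of the projection, which parametrizes `S` by a subset of the hyperplane
  set s := Function.invFunOn π S
  have hs : ∀ x ∈ S, s (π x) = x := fun x hx => hinj.leftInvOn_invFunOn hx
  have hsK : LipschitzOnWith (Real.toNNReal (1 - ε)⁻¹) s (π '' S) := by
    refine LipschitzOnWith.of_dist_le_mul ?_
    rintro _ ⟨x, hx, rfl⟩ _ ⟨y, hy, rfl⟩
    rw [hs x hx, hs y hy, dist_eq_norm, dist_eq_norm, Real.coe_toNNReal _ (inv_pos.2 hε).le]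
    exact hdist x hx y hy
  have hint : ENNReal.ofReal (∫ x in {x | φ x < 0}, fderiv ℝ ψ x ν) =
      ∫⁻ y in π '' S, ENNReal.ofReal (ψ (s y)) := by
    rw [H.setIntegral_fderiv_apply hψ hsupp hs, ofReal_integral_eq_lintegral_ofReal]
    · refine ContinuousOn.integrableOn_compact (hS.image ?_)
        (hψ.continuous.comp_continuousOn hsK.continuousOn)
      exact ContinuousLinearMap.continuous _
    · exact Eventually.of_forall fun y => h0 _
  have hpow : ((Real.toNNReal (1 - ε)⁻¹ : ℝ≥0) : ℝ≥0∞) ^ Module.finrank ℝ (ℝ ∙ ν)ᗮ =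
      ENNReal.ofReal ((1 - ε)⁻¹ ^ Module.finrank ℝ (ℝ ∙ ν)ᗮ) := by
    rw [ENNReal.ofReal_pow (inv_pos.2 hε).le]; rfl
  rw [ENNReal.ofReal_mul (pow_nonneg (inv_pos.2 hε).le _), ← hpow, hint]
  exact lintegral_section_le hS (Submodule.lipschitzWith_orthogonalProjectionOnto _) hs hsK
    hψ.continuous.measurable.ennreal_ofReal

lemma volume_zero_set (H : IsAlmostFlat ε ν φ x₀ r) :
    volume (Metric.ball x₀ r ∩ {x | φ x = 0}) = 0 := by
  refine volume_eq_zero_of_subsingleton_lines H.norm_eq_one (Metric.isOpen_ball.measurableSet.inter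
    (isClosed_eq H.contDiff.continuous continuous_const).measurableSet) fun y s hs t ht => ?_
  exact (H.strictMonoOn_line (y : E)).injOn hs.1 ht.1
    ((show φ _ = 0 from hs.2).trans (show φ _ = 0 from ht.2).symm)

variable {U : Set E}

/-- `U` and `{φ < 0}` differ in the chart at most by the level set `{φ = 0}`, which is null. -/
lemma setIntegral_eq (H : IsAlmostFlat ε ν φ x₀ r) (hUm : NullMeasurableSet U)
    (hU : ∀ x ∈ Metric.ball x₀ r, (φ x < 0 → x ∈ U) ∧ (0 < φ x → x ∉ U)) {k : E → ℝ}
    (hk : ∀ x ∉ Metric.ball x₀ r, k x = 0) :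
    ∫ x in U, k x = ∫ x in {x | φ x < 0}, k x := by
  rw [← integral_indicator₀ hUm, ← integral_indicator
    (isOpen_lt H.contDiff.continuous continuous_const).measurableSet]
  refine integral_congr_ae ?_
  filter_upwards [measure_eq_zero_iff_ae_notMem.1 H.volume_zero_set] with x hx
  by_cases hxB : x ∈ Metric.ball x₀ r
  · have hne : φ x ≠ 0 := fun h => hx ⟨hxB, h⟩
    rcases hne.lt_or_gt with h | h
    · rw [indicator_of_mem ((hU x hxB).1 h), indicator_of_mem (show x ∈ {x | φ x < 0} from h)]
    · rw [indicator_of_notMem ((hU x hxB).2 h),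
        indicator_of_notMem (show x ∉ {x | φ x < 0} from not_lt.2 h.le)]
  · simp [indicator, hk x hxB]

end Surface

end IsAlmostFlat

/-! ### The flux through an almost flat piece -/

/-- The divergence `∑ i, ∂ᵢ ηᵢ` of a vector field on `ℝ^d`, the scalar counterpart of
`divergence`. -/
def scalarDivergence {d : ℕ} (η : EuclideanSpace ℝ (Fin d) → EuclideanSpace ℝ (Fin d))
    (x : EuclideanSpace ℝ (Fin d)) : ℝ :=
  ∑ i, fderiv ℝ (fun y => η y i) x (EuclideanSpace.single i 1)

/-- Smooth decreasing approximations of the indicator function of `(-∞, 0)`. -/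
def cutoff (n : ℕ) (t : ℝ) : ℝ := Real.smoothTransition (-(n * t))

lemma contDiff_cutoff (n : ℕ) : ContDiff ℝ 1 (cutoff n) := by
  unfold cutoff
  exact (Real.smoothTransition.contDiff (n := 1)).comp (by fun_prop)

lemma deriv_cutoff_nonpos (n : ℕ) (t : ℝ) : deriv (cutoff n) t ≤ 0 := by
  have : Antitone (cutoff n) := fun s t hst => Real.smoothTransition.monotone
    (neg_le_neg (mul_le_mul_of_nonneg_left hst n.cast_nonneg))
  exact this.deriv_nonpos

lemma tendsto_integral_cutoff {α : Type*} [MeasurableSpace α] {μ : Measure α} {φ k : α → ℝ}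
    (hφ : Measurable φ) (hk : Integrable k μ) :
    Tendsto (fun n : ℕ => ∫ x, cutoff n (φ x) * k x ∂μ) atTop
      (𝓝 (∫ x in {x | φ x < 0}, k x ∂μ)) := by
  rw [← integral_indicator (measurableSet_lt hφ measurable_const)]
  refine tendsto_integral_of_dominated_convergence (fun x => ‖k x‖) (fun n => ?_) hk.norm
    (fun n => ?_) ?_
  · exact ((contDiff_cutoff n).continuous.measurable.comp hφ).aestronglyMeasurable.mul hk.1
  · refine Eventually.of_forall fun x => ?_
    rw [norm_mul, Real.norm_of_nonneg (show 0 ≤ cutoff n (φ x) from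
      Real.smoothTransition.nonneg _)]
    exact mul_le_of_le_one_left (norm_nonneg _) (Real.smoothTransition.le_one _)
  · refine Eventually.of_forall fun x => tendsto_const_nhds.congr' ?_
    by_cases hx : φ x < 0
    · rw [indicator_of_mem (show x ∈ {x | φ x < 0} from hx)]
      obtain ⟨m, hm⟩ := exists_nat_ge (1 / (-φ x))
      filter_upwards [eventually_ge_atTop m] with n hn
      have h1 : 1 / (-φ x) ≤ n := hm.trans (by exact_mod_cast hn)
      rw [div_le_iff₀ (by linarith)] at h1
      rw [show cutoff n (φ x) = 1 from Real.smoothTransition.one_of_one_le (by linarith), one_mul]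
    · rw [indicator_of_notMem (show x ∉ {x | φ x < 0} from hx)]
      refine Eventually.of_forall fun n => ?_
      have := mul_nonneg n.cast_nonneg (not_lt.1 hx)
      have h0 : cutoff n (φ x) = 0 := Real.smoothTransition.zero_of_nonpos (by linarith)
      simp [h0]

section Flux

variable {d : ℕ} {ε : ℝ} {ν : EuclideanSpace ℝ (Fin d)} {φ : EuclideanSpace ℝ (Fin d) → ℝ}
  {x₀ : EuclideanSpace ℝ (Fin d)} {r : ℝ}

lemma contDiff_coord {η : EuclideanSpace ℝ (Fin d) → EuclideanSpace ℝ (Fin d)}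
    (hη : ContDiff ℝ 1 η) (i : Fin d) : ContDiff ℝ 1 fun x => η x i :=
  (EuclideanSpace.proj (𝕜 := ℝ) i).contDiff.comp hη

lemma hasCompactSupport_coord {η : EuclideanSpace ℝ (Fin d) → EuclideanSpace ℝ (Fin d)}
    (hη : HasCompactSupport η) (i : Fin d) : HasCompactSupport fun x => η x i :=
  hη.comp_left (g := fun v : EuclideanSpace ℝ (Fin d) => v i) (by simp)

lemma integrable_scalarDivergence {η : EuclideanSpace ℝ (Fin d) → EuclideanSpace ℝ (Fin d)}
    (hη : ContDiff ℝ 1 η) (hc : HasCompactSupport η) : Integrable (scalarDivergence η) :=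
  integrable_finsetSum _ fun i _ =>
    integrable_fderiv_apply (contDiff_coord hη i) (hasCompactSupport_coord hc i) _

lemma integral_cutoff_mul_scalarDivergence (hφ : ContDiff ℝ 1 φ) (n : ℕ)
    {η : EuclideanSpace ℝ (Fin d) → EuclideanSpace ℝ (Fin d)} (hη : ContDiff ℝ 1 η)
    (hc : HasCompactSupport η) :
    ∫ x, cutoff n (φ x) * scalarDivergence η x =
      ∫ x, -deriv (cutoff n) (φ x) * fderiv ℝ φ x (η x) := by
  have hχ := contDiff_cutoff n
  have hηx : ∀ x, η x = ∑ i, η x i • EuclideanSpace.single i (1 : ℝ) := fun x => by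
    simpa using ((EuclideanSpace.basisFun (Fin d) ℝ).sum_repr (η x)).symm
  have h1 : ∀ x, -deriv (cutoff n) (φ x) * fderiv ℝ φ x (η x) = ∑ i, -(deriv (cutoff n) (φ x) *
      fderiv ℝ φ x (EuclideanSpace.single i 1) * η x i) := fun x => by
    conv_lhs => rw [hηx x]
    rw [map_sum, Finset.mul_sum]
    refine Finset.sum_congr rfl fun i _ => ?_
    rw [map_smul, smul_eq_mul]; ring
  simp_rw [h1, scalarDivergence, Finset.mul_sum]
  rw [integral_finsetSum, integral_finsetSum]
  · refine Finset.sum_congr rfl fun i _ => ?_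
    rw [integral_comp_mul_fderiv hχ hφ (contDiff_coord hη i) (hasCompactSupport_coord hc i),
      integral_neg]
  · intro i _
    refine Integrable.neg (Continuous.integrable_of_hasCompactSupport ?_
      (hasCompactSupport_coord hc i).mul_left)
    exact (((hχ.continuous_deriv le_rfl).comp hφ.continuous).mul
      (continuous_fderiv_apply_const hφ _)).mul (contDiff_coord hη i).continuous
  · intro i _
    refine Continuous.integrable_of_hasCompactSupport ?_
      ((hasCompactSupport_coord hc i).fderiv_apply ℝ _).mul_left
    exact (hχ.continuous.comp hφ.continuous).mul
      (continuous_fderiv_apply_const (contDiff_coord hη i) _)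

/-- Tangential components of a field do not contribute to its flux through an almost flat piece,
up to a factor close to `1`: the flux of a field `η` with `‖η‖ ≤ ψ` is at most that of `ψ ν`. In
the approximations `∫ -χₙ'(φ) ⟪∇φ, η⟫` of the flux by integrals over thin layers this is a
pointwise inequality. -/
lemma IsAlmostFlat.abs_setIntegral_scalarDivergence_le (H : IsAlmostFlat ε ν φ x₀ r)
    {η : EuclideanSpace ℝ (Fin d) → EuclideanSpace ℝ (Fin d)} (hη : ContDiff ℝ 1 η)
    {ψ : EuclideanSpace ℝ (Fin d) → ℝ} (hψ : ContDiff ℝ 1 ψ)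
    (hsupp : tsupport ψ ⊆ Metric.ball x₀ r) (hle : ∀ x, ‖η x‖ ≤ ψ x) :
    |∫ x in {x | φ x < 0}, scalarDivergence η x| ≤
      (1 + ε) / (1 - ε) * ∫ x in {x | φ x < 0}, fderiv ℝ ψ x ν := by
  have hφ := H.contDiff
  have hψc : HasCompactSupport ψ := hasCompactSupport_of_tsupport_subset_ball hsupp
  have hηc : HasCompactSupport η := hψc.mono fun x hx h0 => hx (by simpa [h0] using hle x)
  have hlim1 := (tendsto_integral_cutoff hφ.continuous.measurable
    (integrable_scalarDivergence hη hηc)).abs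
  have hlim2 := (tendsto_integral_cutoff hφ.continuous.measurable
    (integrable_fderiv_apply hψ hψc ν)).const_mul ((1 + ε) / (1 - ε))
  refine le_of_tendsto_of_tendsto' hlim1 hlim2 fun n => ?_
  have hχ := contDiff_cutoff n
  rw [integral_cutoff_mul_scalarDivergence hφ n hη hηc, integral_comp_mul_fderiv hχ hφ hψ hψc,
    ← integral_neg, ← integral_const_mul, ← Real.norm_eq_abs]
  refine norm_integral_le_of_norm_le ?_ (Eventually.of_forall fun x => ?_)
  · refine Integrable.const_mul (Integrable.neg (Continuous.integrable_of_hasCompactSupport ?_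
      hψc.mul_left)) _
    exact (((hχ.continuous_deriv le_rfl).comp hφ.continuous).mul
      (continuous_fderiv_apply_const hφ _)).mul hψ.continuous
  · have hχ' : 0 ≤ -deriv (cutoff n) (φ x) := neg_nonneg.2 (deriv_cutoff_nonpos n _)
    have hε : 0 < 1 - ε := sub_pos.2 H.lt_one
    by_cases hx : x ∈ Metric.ball x₀ r
    · have h1 : |fderiv ℝ φ x (η x)| ≤ (1 + ε) * ψ x :=
        (H.abs_fderiv_apply_le hx _).trans
          (mul_le_mul_of_nonneg_left (hle x) (by linarith [H.pos]))
      have h2 : ψ x ≤ (1 - ε)⁻¹ * fderiv ℝ φ x ν * ψ x := by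
        refine le_mul_of_one_le_left ((norm_nonneg _).trans (hle x)) ?_
        rw [inv_mul_eq_div, le_div_iff₀ hε, one_mul]
        exact H.one_sub_le_fderiv_apply hx
      rw [norm_mul, Real.norm_of_nonneg hχ', Real.norm_eq_abs]
      calc _ ≤ -deriv (cutoff n) (φ x) * ((1 + ε) * ((1 - ε)⁻¹ * fderiv ℝ φ x ν * ψ x)) :=
            mul_le_mul_of_nonneg_left (h1.trans
              (mul_le_mul_of_nonneg_left h2 (by linarith [H.pos]))) hχ'
        _ = _ := by ring
    · have hψ0 : ψ x = 0 := image_eq_zero_of_notMem_tsupport fun h => hx (hsupp h)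
      have hη0 : η x = 0 := norm_le_zero_iff.1 ((hle x).trans hψ0.le)
      simp [hψ0, hη0]

end Flux

/-! ### Local comparison of flux and surface measure -/

/-- Near a boundary point a set with `C¹` boundary is the sublevel set of an almost flat function:
the defining function is divided by the norm of its gradient at the point and multiplied by a
cutoff function to make it globally `C¹`. -/
lemma HasC1Boundary.exists_isAlmostFlat {d : ℕ} {U : Set (EuclideanSpace ℝ (Fin d))}
    (hU : HasC1Boundary U) {x : EuclideanSpace ℝ (Fin d)} (hx : x ∈ frontier U) {ε : ℝ}
    (hε : 0 < ε) (hε1 : ε < 1) {O : Set (EuclideanSpace ℝ (Fin d))} (hO : O ∈ 𝓝 x) :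
    ∃ (ν : EuclideanSpace ℝ (Fin d)) (φ : EuclideanSpace ℝ (Fin d) → ℝ) (r : ℝ), 0 < r ∧
      Metric.ball x r ⊆ O ∧ IsAlmostFlat ε ν φ x r ∧
      ∀ y ∈ Metric.ball x r, (φ y < 0 → y ∈ U) ∧ (0 < φ y → y ∉ U) := by
  obtain ⟨φ₀, hφ₀, -, hne, hev⟩ := hU x hx
  have hc : 0 < ‖fderiv ℝ φ₀ x‖ := norm_pos_iff.2 hne
  set c := ‖fderiv ℝ φ₀ x‖
  set ν := c⁻¹ • (InnerProductSpace.toDual ℝ _).symm (fderiv ℝ φ₀ x) with hν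
  have hνi : innerSL ℝ ν = c⁻¹ • fderiv ℝ φ₀ x := by
    ext v
    simp [hν]
  have hν1 : ‖ν‖ = 1 := by
    rw [hν, norm_smul, LinearIsometryEquiv.norm_map, Real.norm_of_nonneg (inv_pos.2 hc).le,
      inv_mul_cancel₀ hc.ne']
  obtain ⟨δ, hδ, hball⟩ := Metric.eventually_nhds_iff_ball.1 (hφ₀.eventually (by simp))
  let f : ContDiffBump x := ⟨δ / 3, δ / 2, by positivity, by linarith⟩
  set φ : EuclideanSpace ℝ (Fin d) → ℝ := fun y => f y * (c⁻¹ * φ₀ y) with hφ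
  have hφC : ContDiff ℝ 1 φ := by
    rw [contDiff_iff_contDiffAt]
    intro y
    by_cases hy : y ∈ Metric.ball x δ
    · exact f.contDiff.contDiffAt.mul (contDiffAt_const.mul (hball y hy))
    · have hy' : y ∉ tsupport f := by
        rw [f.tsupport_eq]
        intro h
        refine hy (Metric.closedBall_subset_ball ?_ h)
        change δ / 2 < δ
        linarith
      refine contDiffAt_const (c := (0 : ℝ)) |>.congr_of_eventuallyEq ?_
      filter_upwards [notMem_tsupport_iff_eventuallyEq.1 hy'] with z hz
      simp [hφ, hz]
  have hφeq : ∀ᶠ y in 𝓝 x, φ y = c⁻¹ * φ₀ y := by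
    filter_upwards [f.eventuallyEq_one] with y hy
    simp [hφ, hy]
  have hφx : fderiv ℝ φ x = innerSL ℝ ν := by
    rw [Filter.EventuallyEq.fderiv_eq hφeq, hνi]
    exact fderiv_const_mul (hφ₀.differentiableAt one_ne_zero) _
  have hclose : ∀ᶠ y in 𝓝 x, ‖fderiv ℝ φ y - innerSL ℝ ν‖ ≤ ε := by
    have hcont : Continuous fun y => ‖fderiv ℝ φ y - innerSL ℝ ν‖ :=
      ((hφC.continuous_fderiv one_ne_zero).sub continuous_const).norm
    have : ∀ᶠ y in 𝓝 x, ‖fderiv ℝ φ y - innerSL ℝ ν‖ < ε :=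
      hcont.continuousAt.eventually_lt continuousAt_const (by simpa [hφx] using hε)
    exact this.mono fun y hy => hy.le
  obtain ⟨r, hr, hrball⟩ := Metric.eventually_nhds_iff_ball.1
    (hφeq.and (hclose.and (hev.and hO)))
  refine ⟨ν, φ, r, hr, fun y hy => (hrball y hy).2.2.2,
    ⟨hφC, hν1, hε, hε1, fun y hy => (hrball y hy).2.1⟩, fun y hy => ?_⟩
  obtain ⟨h1, -, ⟨h2, h3⟩, -⟩ := hrball y hy
  rw [h1]
  refine ⟨fun h => h2 ?_, fun h => h3 ?_⟩
  · by_contra! hcon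
    exact absurd h (not_lt.2 (mul_nonneg (inv_pos.2 hc).le hcon))
  · exact (mul_pos_iff_of_pos_left (inv_pos.2 hc)).1 h

/-- The ball `B(x, r)` is small enough for the set `U` to look like a half-space with outer normal
`ν`, up to a factor `1 + δ`: for functions `ψ ≥ 0` supported in the ball, the flux of `ψ ν` out of
`U` is comparable to the integral of `ψ` over the boundary, and it bounds the flux of any field
whose norm is at most `ψ`. -/
structure IsFluxBall {d : ℕ} (U : Set (EuclideanSpace ℝ (Fin d))) (δ : ℝ)
    (x : EuclideanSpace ℝ (Fin d)) (r : ℝ) (ν : EuclideanSpace ℝ (Fin d)) : Prop where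
  norm_eq_one : ‖ν‖ = 1
  flux_le : ∀ ψ : EuclideanSpace ℝ (Fin d) → ℝ, ContDiff ℝ 1 ψ → tsupport ψ ⊆ Metric.ball x r →
    (∀ y, 0 ≤ ψ y) → ENNReal.ofReal (∫ y in U, fderiv ℝ ψ y ν) ≤
      ∫⁻ y in frontier U, ENNReal.ofReal (ψ y) ∂μHE[d - 1]
  le_flux : ∀ ψ : EuclideanSpace ℝ (Fin d) → ℝ, ContDiff ℝ 1 ψ → tsupport ψ ⊆ Metric.ball x r →
    (∀ y, 0 ≤ ψ y) → ∫⁻ y in frontier U, ENNReal.ofReal (ψ y) ∂μHE[d - 1] ≤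
      ENNReal.ofReal ((1 + δ) * ∫ y in U, fderiv ℝ ψ y ν)
  abs_flux_le : ∀ (η : EuclideanSpace ℝ (Fin d) → EuclideanSpace ℝ (Fin d))
    (ψ : EuclideanSpace ℝ (Fin d) → ℝ), ContDiff ℝ 1 η → ContDiff ℝ 1 ψ →
    tsupport ψ ⊆ Metric.ball x r → (∀ y, ‖η y‖ ≤ ψ y) →
    |∫ y in U, scalarDivergence η y| ≤ (1 + δ) * ∫ y in U, fderiv ℝ ψ y ν

lemma scalarDivergence_eq_zero_of_notMem_tsupport {d : ℕ}
    {η : EuclideanSpace ℝ (Fin d) → EuclideanSpace ℝ (Fin d)} {x : EuclideanSpace ℝ (Fin d)}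
    (hx : x ∉ tsupport η) : scalarDivergence η x = 0 := by
  refine Finset.sum_eq_zero fun i _ => ?_
  have : (fun y => η y i) =ᶠ[𝓝 x] fun _ => 0 := by
    filter_upwards [notMem_tsupport_iff_eventuallyEq.1 hx] with y hy
    simp [hy]
  rw [this.fderiv_eq]
  simp

lemma IsAlmostFlat.isFluxBall {d : ℕ} {U : Set (EuclideanSpace ℝ (Fin d))} {ε δ r : ℝ}
    {ν x : EuclideanSpace ℝ (Fin d)} {φ : EuclideanSpace ℝ (Fin d) → ℝ}
    (H : IsAlmostFlat ε ν φ x r) (hUm : NullMeasurableSet U)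
    (hU : ∀ y ∈ Metric.ball x r, (φ y < 0 → y ∈ U) ∧ (0 < φ y → y ∉ U))
    (hδ1 : (1 - ε)⁻¹ ^ (d - 1) ≤ 1 + δ) (hδ2 : (1 + ε) / (1 - ε) ≤ 1 + δ) :
    IsFluxBall U δ x r ν := by
  have hε : 0 < 1 - ε := sub_pos.2 H.lt_one
  have hεp := H.pos
  have hrank : Module.finrank ℝ (ℝ ∙ ν)ᗮ = d - 1 := by
    have hν0 : ν ≠ 0 := fun h => by simpa [h] using H.norm_eq_one
    have h1 := (ℝ ∙ ν).finrank_add_finrank_orthogonal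
    rw [finrank_span_singleton hν0, finrank_euclideanSpace_fin] at h1
    omega
  have hint : ∀ ψ : EuclideanSpace ℝ (Fin d) → ℝ, tsupport ψ ⊆ Metric.ball x r →
      ∫ y in U, fderiv ℝ ψ y ν = ∫ y in {y | φ y < 0}, fderiv ℝ ψ y ν := fun ψ hs =>
    H.setIntegral_eq hUm hU fun y hy => by
      have := notMem_tsupport_iff_eventuallyEq.1 fun h => hy (hs h)
      rw [this.fderiv_eq]; simp
  have hsurf : ∀ ψ : EuclideanSpace ℝ (Fin d) → ℝ, tsupport ψ ⊆ Metric.ball x r →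
      ∫⁻ y in frontier U, ENNReal.ofReal (ψ y) ∂μHE[d - 1] =
      ∫⁻ y in tsupport ψ ∩ {y | φ y = 0}, ENNReal.ofReal (ψ y) ∂μHE[d - 1] := fun ψ hs => by
    rw [← lintegral_indicator isClosed_frontier.measurableSet, ← lintegral_indicator
      ((isClosed_tsupport ψ).inter (isClosed_eq H.contDiff.continuous
        continuous_const)).measurableSet]
    congr 1
    ext y
    by_cases hy : y ∈ tsupport ψ
    · have := H.mem_frontier_iff hU (hs hy)
      simp [indicator, hy, this]
    · simp [indicator, image_eq_zero_of_notMem_tsupport hy]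
  -- the field `η = 0` shows that fluxes of nonnegative fields are nonnegative
  have hnonneg : ∀ ψ : EuclideanSpace ℝ (Fin d) → ℝ, ContDiff ℝ 1 ψ →
      tsupport ψ ⊆ Metric.ball x r → (∀ y, 0 ≤ ψ y) →
      0 ≤ ∫ y in {y | φ y < 0}, fderiv ℝ ψ y ν := fun ψ hψ hs h0 => by
    have := (abs_nonneg _).trans (H.abs_setIntegral_scalarDivergence_le (η := fun _ => 0)
      contDiff_const hψ hs (by simpa using h0))
    exact (mul_nonneg_iff_of_pos_left (by positivity)).1 this
  refine ⟨H.norm_eq_one, fun ψ hψ hs h0 => ?_, fun ψ hψ hs h0 => ?_, fun η ψ hη hψ hs hle => ?_⟩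
  · have := (H.lintegral_zero_set hψ hs h0).1
    rwa [hrank, ← hsurf ψ hs, ← hint ψ hs] at this
  · have := (H.lintegral_zero_set hψ hs h0).2
    rw [hrank, ← hsurf ψ hs] at this
    refine this.trans (ENNReal.ofReal_le_ofReal ?_)
    rw [hint ψ hs]
    exact mul_le_mul_of_nonneg_right hδ1 (hnonneg ψ hψ hs h0)
  · have hηs : tsupport η ⊆ tsupport ψ := closure_mono fun y hy h0 => hy (by
      simpa [h0] using hle y)
    rw [hint ψ hs, H.setIntegral_eq hUm hU fun y hy =>
      scalarDivergence_eq_zero_of_notMem_tsupport fun h => hy (hs (hηs h))]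
    exact (H.abs_setIntegral_scalarDivergence_le hη hψ hs hle).trans
      (mul_le_mul_of_nonneg_right hδ2 (hnonneg ψ hψ hs fun y => (norm_nonneg _).trans (hle y)))

lemma HasC1Boundary.exists_isFluxBall {d : ℕ} {U : Set (EuclideanSpace ℝ (Fin d))}
    (hU : HasC1Boundary U) (hUm : NullMeasurableSet U) {δ : ℝ} (hδ : 0 < δ)
    {x : EuclideanSpace ℝ (Fin d)} (hx : x ∈ frontier U)
    {O : Set (EuclideanSpace ℝ (Fin d))} (hO : O ∈ 𝓝 x) :
    ∃ (r : ℝ) (ν : EuclideanSpace ℝ (Fin d)), 0 < r ∧ Metric.ball x r ⊆ O ∧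
      IsFluxBall U δ x r ν := by
  -- both constants of the flat chart tend to `1` as `ε → 0`
  have h1 : ContinuousAt (fun ε : ℝ => (1 - ε)⁻¹ ^ (d - 1)) 0 := by
    refine ContinuousAt.pow (ContinuousAt.inv₀ (by fun_prop) (by simp)) _
  have h2 : ContinuousAt (fun ε : ℝ => (1 + ε) / (1 - ε)) 0 :=
    ContinuousAt.div (by fun_prop) (by fun_prop) (by simp)
  have h3 : ∀ᶠ ε : ℝ in 𝓝[>] 0, (1 - ε)⁻¹ ^ (d - 1) < 1 + δ ∧ (1 + ε) / (1 - ε) < 1 + δ ∧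
      ε < 1 := by
    refine Filter.Eventually.filter_mono nhdsWithin_le_nhds ?_
    refine (h1.eventually_lt continuousAt_const (by simpa using hδ)).and
      ((h2.eventually_lt continuousAt_const (by simpa using hδ)).and ?_)
    exact eventually_lt_nhds one_pos
  obtain ⟨ε, ⟨hε1, hε2, hε3⟩, hε⟩ := (h3.and self_mem_nhdsWithin).exists
  obtain ⟨ν, φ, r, hr, hrO, H, hUφ⟩ := hU.exists_isAlmostFlat hx hε hε3 hO
  exact ⟨r, ν, hr, hrO, H.isFluxBall hUm hUφ hε1.le hε2.le⟩

/-! ### The perimeter of a bounded set with `C¹` boundary -/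

section Perimeter

variable {d : ℕ} {U Ω : Set (EuclideanSpace ℝ (Fin d))}

/-- A finite smooth partition of unity near the boundary of `U`, subordinate to balls in which
`U` is almost a half-space. -/
lemma HasC1Boundary.exists_partition (hU : HasC1Boundary U) (hUm : NullMeasurableSet U)
    (hK : IsCompact (frontier U)) (hΩ : IsOpen Ω) (hUΩ : frontier U ⊆ Ω) {δ : ℝ} (hδ : 0 < δ) :
    ∃ (t : Finset (frontier U)) (ψ : t → EuclideanSpace ℝ (Fin d) → ℝ) (r : t → ℝ)
      (ν : t → EuclideanSpace ℝ (Fin d)), (∀ i, ContDiff ℝ 1 (ψ i)) ∧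
      (∀ i, tsupport (ψ i) ⊆ Metric.ball (i : frontier U) (r i)) ∧
      (∀ i : t, Metric.ball ((i : frontier U) : EuclideanSpace ℝ (Fin d)) (r i) ⊆ Ω) ∧
      (∀ i : t, IsFluxBall U δ (i : frontier U) (r i) (ν i)) ∧ (∀ i x, 0 ≤ ψ i x) ∧
      (∀ x, ∑ i, ψ i x ≤ 1) ∧ ∀ᶠ x in 𝓝ˢ (frontier U), ∑ i, ψ i x = 1 := by
  choose r ν hr hrΩ hflux using fun x : frontier U =>
    hU.exists_isFluxBall hUm hδ x.2 (hΩ.mem_nhds (hUΩ x.2))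
  obtain ⟨t, ht⟩ := hK.elim_finite_subcover
    (fun x : frontier U => Metric.ball (x : EuclideanSpace ℝ (Fin d)) (r x))
    (fun _ => Metric.isOpen_ball)
    fun x hx => mem_iUnion.2 ⟨⟨x, hx⟩, Metric.mem_ball_self (hr _)⟩
  have hopen : IsOpen (⋃ x ∈ t, Metric.ball (x : EuclideanSpace ℝ (Fin d)) (r x)) :=
    isOpen_biUnion fun _ _ => Metric.isOpen_ball
  obtain ⟨ρ, hρ, hρt⟩ := hK.exists_cthickening_subset_open hopen ht
  obtain ⟨f, hf⟩ := SmoothPartitionOfUnity.exists_isSubordinate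
    (modelWithCornersSelf ℝ (EuclideanSpace ℝ (Fin d)))
    (Metric.isClosed_cthickening (δ := ρ) (E := frontier U))
    (fun i : t => Metric.ball ((i : frontier U) : EuclideanSpace ℝ (Fin d)) (r i))
    (fun _ => Metric.isOpen_ball) (by
      intro x hx
      obtain ⟨y, hy, hxy⟩ := mem_iUnion₂.1 (hρt hx)
      exact mem_iUnion.2 ⟨⟨y, hy⟩, hxy⟩)
  refine ⟨t, fun i => f i, fun i => r i, fun i => ν i, fun i => ?_, hf, fun i => hrΩ i,
    fun i => hflux i, fun i x => f.nonneg i x, fun x => ?_, ?_⟩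
  · exact ((f i).contMDiff.contDiff).of_le (by exact_mod_cast le_top)
  · rw [← finsum_eq_sum_of_fintype]
    exact f.sum_le_one x
  · refine Filter.mem_of_superset (x := Metric.cthickening ρ (frontier U)) ?_ fun x hx => ?_
    · exact mem_of_superset ((Metric.isOpen_thickening).mem_nhdsSet.2
        (Metric.self_subset_thickening hρ _)) (Metric.thickening_subset_cthickening _ _)
    · change ∑ i, f i x = 1
      rw [← finsum_eq_sum_of_fintype]
      exact f.sum_eq_one hx

lemma scalarDivergence_add {η ζ : EuclideanSpace ℝ (Fin d) → EuclideanSpace ℝ (Fin d)}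
    (hη : ContDiff ℝ 1 η) (hζ : ContDiff ℝ 1 ζ) (x : EuclideanSpace ℝ (Fin d)) :
    scalarDivergence (fun y => η y + ζ y) x = scalarDivergence η x + scalarDivergence ζ x := by
  simp only [scalarDivergence, ← Finset.sum_add_distrib, PiLp.add_apply]
  refine Finset.sum_congr rfl fun i _ => ?_
  rw [fderiv_fun_add ((contDiff_coord hη i).differentiable one_ne_zero x)
    ((contDiff_coord hζ i).differentiable one_ne_zero x)]
  rfl

lemma scalarDivergence_sum {ι : Type*} (s : Finset ι)
    {η : ι → EuclideanSpace ℝ (Fin d) → EuclideanSpace ℝ (Fin d)}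
    (hη : ∀ i, ContDiff ℝ 1 (η i)) (x : EuclideanSpace ℝ (Fin d)) :
    scalarDivergence (fun y => ∑ i ∈ s, η i y) x = ∑ i ∈ s, scalarDivergence (η i) x := by
  classical
  induction s using Finset.induction_on with
  | empty => simp [scalarDivergence]
  | insert i s hi ih =>
    simp only [Finset.sum_insert hi]
    rw [scalarDivergence_add (hη i) (ContDiff.sum fun j _ => hη j), ih]

lemma scalarDivergence_neg (η : EuclideanSpace ℝ (Fin d) → EuclideanSpace ℝ (Fin d))
    (x : EuclideanSpace ℝ (Fin d)) :
    scalarDivergence (fun y => -η y) x = -scalarDivergence η x := by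
  simp [scalarDivergence, fderiv_fun_neg]

lemma scalarDivergence_const_smul (c : ℝ)
    {η : EuclideanSpace ℝ (Fin d) → EuclideanSpace ℝ (Fin d)} (hη : ContDiff ℝ 1 η)
    (x : EuclideanSpace ℝ (Fin d)) :
    scalarDivergence (fun y => c • η y) x = c * scalarDivergence η x := by
  simp only [scalarDivergence, Finset.mul_sum, PiLp.smul_apply, smul_eq_mul]
  refine Finset.sum_congr rfl fun i _ => ?_
  rw [fderiv_const_mul ((contDiff_coord hη i).differentiable one_ne_zero x)]
  rfl

lemma scalarDivergence_smul_const {ψ : EuclideanSpace ℝ (Fin d) → ℝ} (hψ : ContDiff ℝ 1 ψ)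
    (ν x : EuclideanSpace ℝ (Fin d)) :
    scalarDivergence (fun y => ψ y • ν) x = fderiv ℝ ψ x ν := by
  have hν : ν = ∑ i, ν i • EuclideanSpace.single i (1 : ℝ) := by
    simpa using ((EuclideanSpace.basisFun (Fin d) ℝ).sum_repr ν).symm
  conv_rhs => rw [hν]
  rw [map_sum, scalarDivergence]
  refine Finset.sum_congr rfl fun i _ => ?_
  simp only [PiLp.smul_apply, smul_eq_mul]
  rw [fderiv_mul_const (hψ.differentiable one_ne_zero x)]
  simp

lemma integral_scalarDivergence_eq_zero
    {η : EuclideanSpace ℝ (Fin d) → EuclideanSpace ℝ (Fin d)} (hη : ContDiff ℝ 1 η)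
    (hc : HasCompactSupport η) : ∫ x, scalarDivergence η x = 0 := by
  simp only [scalarDivergence]
  rw [integral_finsetSum]
  · exact Finset.sum_eq_zero fun i _ =>
      integral_fderiv_apply_eq_zero (contDiff_coord hη i) (hasCompactSupport_coord hc i) _
  · exact fun i _ => integrable_fderiv_apply (contDiff_coord hη i) (hasCompactSupport_coord hc i) _

lemma setIntegral_scalarDivergence_eq_zero_of_disjoint_frontier (hUm : NullMeasurableSet U)
    {η : EuclideanSpace ℝ (Fin d) → EuclideanSpace ℝ (Fin d)} (hη : ContDiff ℝ 1 η)
    (hc : HasCompactSupport η) (hd : Disjoint (tsupport η) (frontier U)) :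
    ∫ x in U, scalarDivergence η x = 0 := by
  simp only [scalarDivergence]
  rw [integral_finsetSum]
  · refine Finset.sum_eq_zero fun i _ => ?_
    have hs : tsupport (fun x => η x i) ⊆ tsupport η :=
      closure_mono fun x hx h0 => hx (by simp [h0])
    exact setIntegral_fderiv_eq_zero_of_disjoint_frontier hUm (contDiff_coord hη i)
      (hasCompactSupport_coord hc i) (hd.mono_left hs) _
  · exact fun i _ => (integrable_fderiv_apply (contDiff_coord hη i)
      (hasCompactSupport_coord hc i) _).integrableOn

/-- Up to a factor `1 + δ`, the perimeter of `U` is attained by a vector field `η` with `‖η‖ ≤ 1`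
that is close to the outer normal on the boundary, and no other vector field does better. -/
lemma HasC1Boundary.exists_almost_optimal_field (hU : HasC1Boundary U)
    (hUm : NullMeasurableSet U) (hK : IsCompact (frontier U)) (hΩ : IsOpen Ω)
    (hUΩ : frontier U ⊆ Ω) {δ : ℝ} (hδ : 0 < δ) :
    ∃ η : EuclideanSpace ℝ (Fin d) → EuclideanSpace ℝ (Fin d), ContDiff ℝ 1 η ∧
      HasCompactSupport η ∧ tsupport η ⊆ Ω ∧ (∀ x, ‖η x‖ ≤ 1) ∧
      0 ≤ ∫ x in U, scalarDivergence η x ∧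
      ENNReal.ofReal (∫ x in U, scalarDivergence η x) ≤ μHE[d - 1] (frontier U) ∧
      μHE[d - 1] (frontier U) ≤ ENNReal.ofReal ((1 + δ) * ∫ x in U, scalarDivergence η x) ∧
      ∀ (ζ : EuclideanSpace ℝ (Fin d) → EuclideanSpace ℝ (Fin d)) (M : ℝ), ContDiff ℝ 1 ζ →
        HasCompactSupport ζ → (∀ x, ‖ζ x‖ ≤ M) →
        ∫ x in U, scalarDivergence ζ x ≤ (1 + δ) * M * ∫ x in U, scalarDivergence η x := by
  obtain ⟨t, ψ, r, ν, hψ, hsupp, hballΩ, hflux, h0, hle1, heq1⟩ :=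
    hU.exists_partition hUm hK hΩ hUΩ hδ
  have hψc : ∀ i, HasCompactSupport (ψ i) := fun i =>
    Metric.isCompact_of_isClosed_isBounded (isClosed_tsupport _)
      (Metric.isBounded_ball.subset (hsupp i))
  set η : EuclideanSpace ℝ (Fin d) → EuclideanSpace ℝ (Fin d) := fun x => ∑ i, ψ i x • ν i with hη
  have hsmul : ∀ i, ContDiff ℝ 1 fun x => ψ i x • ν i := fun i => (hψ i).smul contDiff_const
  have hηC : ContDiff ℝ 1 η := ContDiff.sum fun i _ => hsmul i
  have hηs : tsupport η ⊆ ⋃ i, tsupport (ψ i) := by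
    refine closure_minimal (fun x hx => ?_) (isClosed_iUnion_of_finite fun i =>
      isClosed_tsupport (ψ i))
    by_contra hcon
    rw [mem_iUnion, not_exists] at hcon
    refine hx (Finset.sum_eq_zero fun i _ => ?_)
    rw [image_eq_zero_of_notMem_tsupport (hcon i), zero_smul]
  have hηc : HasCompactSupport η :=
    (isCompact_iUnion hψc).of_isClosed_subset (isClosed_tsupport η) hηs
  set I : t → ℝ := fun i => ∫ x in U, fderiv ℝ (ψ i) x (ν i)
  have hηI : ∫ x in U, scalarDivergence η x = ∑ i, I i := by
    simp_rw [hη, scalarDivergence_sum _ hsmul, fun i => scalarDivergence_smul_const (hψ i) (ν i)]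
    exact integral_finsetSum _ fun i _ => (integrable_fderiv_apply (hψ i) (hψc i) _).integrableOn
  have hI0 : ∀ i, 0 ≤ I i := fun i => by
    have := (abs_nonneg _).trans ((hflux i).abs_flux_le (fun _ => 0) (ψ i) contDiff_const (hψ i)
      (hsupp i) (by simpa using h0 i))
    exact (mul_nonneg_iff_of_pos_left (by linarith)).1 this
  have hH : μHE[d - 1] (frontier U) =
      ∑ i, ∫⁻ x in frontier U, ENNReal.ofReal (ψ i x) ∂μHE[d - 1] := by
    rw [← lintegral_finsetSum _ fun i _ => (hψ i).continuous.measurable.ennreal_ofReal,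
      ← setLIntegral_one]
    refine setLIntegral_congr_fun isClosed_frontier.measurableSet fun x hx => ?_
    have h1 : ∑ i, ψ i x = 1 := heq1.self_of_nhdsSet x hx
    change 1 = ∑ i, ENNReal.ofReal (ψ i x)
    rw [← ENNReal.ofReal_sum_of_nonneg fun i _ => h0 i x, h1, ENNReal.ofReal_one]
  refine ⟨η, hηC, hηc, ?_, fun x => ?_, ?_, ?_, ?_, fun ζ M hζ hζc hζM => ?_⟩
  · exact hηs.trans (iUnion_subset fun i => (hsupp i).trans (hballΩ i))
  · calc ‖η x‖ ≤ ∑ i, ‖ψ i x • ν i‖ := norm_sum_le _ _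
      _ = ∑ i, ψ i x := Finset.sum_congr rfl fun i _ => by
        rw [norm_smul, (hflux i).norm_eq_one, mul_one, Real.norm_of_nonneg (h0 i x)]
      _ ≤ 1 := hle1 x
  · rw [hηI]
    exact Finset.sum_nonneg fun i _ => hI0 i
  · rw [hηI, hH, ENNReal.ofReal_sum_of_nonneg fun i _ => hI0 i]
    exact Finset.sum_le_sum fun i _ => (hflux i).flux_le (ψ i) (hψ i) (hsupp i) (h0 i)
  · rw [hηI, hH, Finset.mul_sum, ENNReal.ofReal_sum_of_nonneg fun i _ =>
      mul_nonneg (by linarith) (hI0 i)]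
    exact Finset.sum_le_sum fun i _ => (hflux i).le_flux (ψ i) (hψ i) (hsupp i) (h0 i)
  · -- split `ζ` into pieces supported in the balls and a remainder vanishing near the boundary
    have hpC : ∀ i, ContDiff ℝ 1 fun x => ψ i x • ζ x := fun i => (hψ i).smul hζ
    have hpc : ∀ i, HasCompactSupport fun x => ψ i x • ζ x := fun i => hζc.smul_left (f := ψ i)
    have hsumC : ContDiff ℝ 1 fun x => ∑ i, ψ i x := ContDiff.sum fun i _ => hψ i
    have hrC : ContDiff ℝ 1 fun x => (1 - ∑ i, ψ i x) • ζ x := (contDiff_const.sub hsumC).smul hζ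
    have hrc : HasCompactSupport fun x => (1 - ∑ i, ψ i x) • ζ x :=
      hζc.smul_left (f := fun x => 1 - ∑ i, ψ i x)
    have hrd : Disjoint (tsupport fun x => (1 - ∑ i, ψ i x) • ζ x) (frontier U) := by
      rw [disjoint_right]
      intro x hx
      rw [notMem_tsupport_iff_eventuallyEq]
      filter_upwards [eventually_nhdsSet_iff_forall.1 heq1 x hx] with y hy
      change (1 - ∑ i, ψ i y) • ζ y = 0
      rw [hy, sub_self, zero_smul]
    have hsplit : ζ = fun x => (∑ i, ψ i x • ζ x) + (1 - ∑ i, ψ i x) • ζ x := by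
      ext1 x
      rw [← Finset.sum_smul, ← add_smul, add_sub_cancel, one_smul]
    have hdiv : ∀ x, scalarDivergence ζ x = (∑ i, scalarDivergence (fun x => ψ i x • ζ x) x) +
        scalarDivergence (fun x => (1 - ∑ i, ψ i x) • ζ x) x := fun x => by
      conv_lhs => rw [hsplit]
      rw [scalarDivergence_add (ContDiff.sum fun i _ => hpC i) hrC, scalarDivergence_sum _ hpC]
    simp_rw [hdiv]
    rw [integral_add (integrable_finsetSum _ fun i _ =>
        (integrable_scalarDivergence (hpC i) (hpc i)).integrableOn)
      (integrable_scalarDivergence hrC hrc).integrableOn,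
      setIntegral_scalarDivergence_eq_zero_of_disjoint_frontier hUm hrC hrc hrd, add_zero,
      integral_finsetSum _ fun i _ => (integrable_scalarDivergence (hpC i) (hpc i)).integrableOn,
      hηI, Finset.mul_sum]
    refine Finset.sum_le_sum fun i _ => (le_abs_self _).trans ?_
    have hMψ : ContDiff ℝ 1 fun x => M * ψ i x := contDiff_const.mul (hψ i)
    refine ((hflux i).abs_flux_le _ (fun x => M * ψ i x) (hpC i) hMψ ?_ fun x => ?_).trans_eq ?_
    · have hs : tsupport (fun x => M * ψ i x) ⊆ tsupport (ψ i) :=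
        closure_mono fun x hx h => hx (by simp [h])
      exact hs.trans (hsupp i)
    · rw [norm_smul, Real.norm_of_nonneg (h0 i x), mul_comm]
      exact mul_le_mul_of_nonneg_right (hζM x) (h0 i x)
    · have : ∀ x, fderiv ℝ (fun x => M * ψ i x) x (ν i) = M * fderiv ℝ (ψ i) x (ν i) := fun x => by
        rw [fderiv_const_mul ((hψ i).differentiable one_ne_zero x)]; simp
      simp_rw [this, integral_const_mul]
      ring

lemma HasC1Boundary.euclideanHausdorffMeasure_frontier_ne_top (hU : HasC1Boundary U)
    (hUm : NullMeasurableSet U) (hK : IsCompact (frontier U)) :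
    μHE[d - 1] (frontier U) ≠ ⊤ := by
  obtain ⟨η, -, -, -, -, -, -, h, -⟩ := hU.exists_almost_optimal_field hUm hK isOpen_univ
    (subset_univ _) one_pos
  exact ne_top_of_le_ne_top ENNReal.ofReal_ne_top h

lemma HasC1Boundary.setIntegral_scalarDivergence_le (hU : HasC1Boundary U)
    (hUm : NullMeasurableSet U) (hK : IsCompact (frontier U))
    {ζ : EuclideanSpace ℝ (Fin d) → EuclideanSpace ℝ (Fin d)} {M : ℝ} (hζ : ContDiff ℝ 1 ζ)
    (hζc : HasCompactSupport ζ) (hζM : ∀ x, ‖ζ x‖ ≤ M) :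
    ∫ x in U, scalarDivergence ζ x ≤ M * (μHE[d - 1] (frontier U)).toReal := by
  have hM : 0 ≤ M := (norm_nonneg _).trans (hζM 0)
  have hlim : Tendsto (fun δ : ℝ => (1 + δ) * M * (μHE[d - 1] (frontier U)).toReal) (𝓝[>] 0)
      (𝓝 (M * (μHE[d - 1] (frontier U)).toReal)) := by
    have : Continuous fun δ : ℝ => (1 + δ) * M * (μHE[d - 1] (frontier U)).toReal := by fun_prop
    simpa using (this.tendsto 0).mono_left nhdsWithin_le_nhds
  refine ge_of_tendsto hlim ?_
  filter_upwards [self_mem_nhdsWithin] with δ hδ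
  obtain ⟨η, -, -, -, -, -, h, -, h'⟩ := hU.exists_almost_optimal_field hUm hK isOpen_univ
    (subset_univ _) hδ
  refine (h' ζ M hζ hζc hζM).trans (mul_le_mul_of_nonneg_left ?_
    (mul_nonneg (by linarith [mem_Ioi.1 hδ]) hM))
  exact (ENNReal.ofReal_le_iff_le_toReal
    (hU.euclideanHausdorffMeasure_frontier_ne_top hUm hK)).1 h

end Perimeter

/-! ### Reduction to scalar fields -/

section Reduction

variable {d : ℕ} {V : Type*} [NormedAddCommGroup V] [NormedSpace ℝ V]

/-- The vector field on `ℝ^d` obtained by evaluating a field with values in `(V*)^d` at `v`. -/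
def evalField (p : EuclideanSpace ℝ (Fin d) → Fin d → StrongDual ℝ V) (v : V)
    (x : EuclideanSpace ℝ (Fin d)) : EuclideanSpace ℝ (Fin d) :=
  WithLp.toLp 2 fun i => p x i v

lemma contDiff_evalField {p : EuclideanSpace ℝ (Fin d) → Fin d → StrongDual ℝ V}
    (hp : ContDiff ℝ 1 p) (v : V) : ContDiff ℝ 1 (evalField p v) := by
  rw [contDiff_euclidean]
  exact fun i => (contDiff_pi.1 hp i).clm_apply contDiff_const

lemma tsupport_evalField_subset (p : EuclideanSpace ℝ (Fin d) → Fin d → StrongDual ℝ V) (v : V) :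
    tsupport (evalField p v) ⊆ tsupport p :=
  closure_mono fun x hx h0 => hx (by ext i; simp [evalField, h0])

lemma divergence_apply {p : EuclideanSpace ℝ (Fin d) → Fin d → StrongDual ℝ V}
    (hp : ContDiff ℝ 1 p) (x : EuclideanSpace ℝ (Fin d)) (v : V) :
    divergence p x v = scalarDivergence (evalField p v) x := by
  simp only [divergence, scalarDivergence, evalField, sum_apply]
  refine Finset.sum_congr rfl fun i _ => ?_
  have h1 := ((contDiff_pi.1 hp i).differentiable one_ne_zero x).hasFDerivAt
  have h2 := (h1.clm_apply (hasFDerivAt_const v x)).fderiv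
  rw [h2]
  simp

/-- Testing a two-valued function against a field only sees the jump: the constant part integrates
to zero. -/
lemma integral_divergence_apply_eq {Ω U : Set (EuclideanSpace ℝ (Fin d))}
    (hUm : NullMeasurableSet U) {uPlus uMinus : V}
    {u : EuclideanSpace ℝ (Fin d) → V} (hu_in : ∀ x ∈ U, u x = uPlus)
    (hu_out : ∀ x ∈ Ω \ U, u x = uMinus)
    {p : EuclideanSpace ℝ (Fin d) → Fin d → StrongDual ℝ V} (hp : ContDiff ℝ 1 p)
    (hc : HasCompactSupport p) (hpΩ : tsupport p ⊆ Ω) :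
    ∫ x in Ω, (-divergence p x) (u x) =
      -∫ x in U, scalarDivergence (evalField p (uPlus - uMinus)) x := by
  have hcv : ∀ v, HasCompactSupport (evalField p v) := fun v =>
    IsCompact.of_isClosed_subset hc (isClosed_tsupport _) (tsupport_evalField_subset p v)
  have hdiv0 : ∀ x ∉ Ω, ∀ v, divergence p x v = 0 := fun x hx v => by
    rw [divergence_apply hp]
    exact scalarDivergence_eq_zero_of_notMem_tsupport fun h =>
      hx (hpΩ (tsupport_evalField_subset p v h))
  rw [setIntegral_eq_integral_of_forall_compl_eq_zero fun x hx => by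
    rw [neg_apply, hdiv0 x hx, neg_zero]]
  have hpt : ∀ x, (-divergence p x) (u x) = -scalarDivergence (evalField p uMinus) x -
      U.indicator (scalarDivergence (evalField p (uPlus - uMinus))) x := fun x => by
    rw [neg_apply, ← divergence_apply hp]
    by_cases hxU : x ∈ U
    · rw [hu_in x hxU, indicator_of_mem hxU, ← divergence_apply hp, map_sub]
      ring
    · rw [indicator_of_notMem hxU, sub_zero]
      by_cases hxΩ : x ∈ Ω
      · rw [hu_out x ⟨hxΩ, hxU⟩]
      · rw [hdiv0 x hxΩ, hdiv0 x hxΩ]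
  simp_rw [hpt]
  have hi := fun v => integrable_scalarDivergence (contDiff_evalField hp v) (hcv v)
  have hneg : Integrable fun x => -scalarDivergence (evalField p uMinus) x := (hi uMinus).neg
  rw [integral_sub hneg ((hi _).indicator₀ hUm), integral_neg, integral_scalarDivergence_eq_zero (contDiff_evalField hp _) (hcv _),
    integral_indicator₀ hUm]
  simp

/-- The lower bound on the norm `N` says that evaluation at `v` maps the unit ball of `N` into the
Euclidean ball of radius `‖v‖`. -/
lemma norm_evalField_le {N : Seminorm ℝ (Fin d → StrongDual ℝ V)}
    (hlower : ∀ (x : EuclideanSpace ℝ (Fin d)) (p : Fin d → StrongDual ℝ V) (v : V),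
      |∑ i, x i * p i v| ≤ ‖x‖ * N p * ‖v‖)
    {p : EuclideanSpace ℝ (Fin d) → Fin d → StrongDual ℝ V} {x : EuclideanSpace ℝ (Fin d)}
    (hp : N (p x) ≤ 1) (v : V) : ‖evalField p v x‖ ≤ ‖v‖ := by
  have h1 := (le_abs_self _).trans (hlower (evalField p v x) (p x) v)
  have h2 : ∑ i, evalField p v x i * p x i v = ‖evalField p v x‖ ^ 2 := by
    rw [EuclideanSpace.real_norm_sq_eq]
    exact Finset.sum_congr rfl fun i _ => (sq _).symm
  rw [h2] at h1
  by_contra! hcon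
  have hpos : 0 < ‖evalField p v x‖ := (norm_nonneg v).trans_lt hcon
  have h3 : ‖evalField p v x‖ * N (p x) * ‖v‖ ≤ ‖evalField p v x‖ * 1 * ‖v‖ := by gcongr
  nlinarith

end Reduction

end CartoonTV

end

theorem mainTheorem2 {d : ℕ} (hd : 1 ≤ d)
    {V : Type*} [NormedAddCommGroup V] [NormedSpace ℝ V] [CompleteSpace V]
    (N : Seminorm ℝ (Fin d → StrongDual ℝ V)) (hN : ∀ p, N p = 0 → p = 0)
    (hlower : ∀ (x : EuclideanSpace ℝ (Fin d)) (p : Fin d → StrongDual ℝ V) (v : V),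
      |∑ i, x i * p i v| ≤ ‖x‖ * N p * ‖v‖)
    (hupper : ∀ (x : EuclideanSpace ℝ (Fin d)) (q : StrongDual ℝ V),
      N (fun i => x i • q) ≤ ‖x‖ * ‖q‖)
    (Ω U : Set (EuclideanSpace ℝ (Fin d)))
    (hΩ : IsOpen Ω) (hΩb : Bornology.IsBounded Ω)
    (hUm : NullMeasurableSet U volume)
    (hUΩ : CartoonTV.CompactlyContained U Ω) (hU : CartoonTV.HasC1Boundary U)
    (uPlus uMinus : V) (u : EuclideanSpace ℝ (Fin d) → V)
    (hu_in : ∀ x ∈ U, u x = uPlus) (hu_out : ∀ x ∈ Ω \ U, u x = uMinus) :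
    CartoonTV.totalVariation N Ω u =
      ((μHE[d - 1] (frontier U) * ‖uPlus - uMinus‖ₑ : ENNReal) : EReal) := by
  have hK : IsCompact (frontier U) :=
    hUΩ.1.of_isClosed_subset isClosed_frontier frontier_subset_closure
  have htop := hU.euclideanHausdorffMeasure_frontier_ne_top hUm hK
  set w := uPlus - uMinus with hw
  set h := (μHE[d - 1] (frontier U)).toReal
  have hrhs : ((μHE[d - 1] (frontier U) * ‖w‖ₑ : ENNReal) : EReal) = ((‖w‖ * h : ℝ) : EReal) := by
    rw [← ENNReal.ofReal_toReal htop, ← ofReal_norm, ← ENNReal.ofReal_mul ENNReal.toReal_nonneg,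
      EReal.coe_ennreal_ofReal, max_eq_left (by positivity), mul_comm]
  rw [hrhs]
  apply le_antisymm
  · refine iSup₂_le fun p hp => EReal.coe_le_coe_iff.2 ?_
    rw [CartoonTV.integral_divergence_apply_eq hUm hu_in hu_out hp.contDiff
      hp.hasCompactSupport hp.tsupport_subset, ← integral_neg]
    simp_rw [← CartoonTV.scalarDivergence_neg]
    refine hU.setIntegral_scalarDivergence_le hUm hK
      (CartoonTV.contDiff_evalField hp.contDiff _).neg ?_ fun x => ?_
    · exact HasCompactSupport.neg (hp.hasCompactSupport.of_isClosed_subset (isClosed_tsupport _)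
        (CartoonTV.tsupport_evalField_subset p _))
    · rw [norm_neg]
      by_cases hx : x ∈ Ω
      · exact CartoonTV.norm_evalField_le hlower (hp.norm_le x hx) w
      · rw [image_eq_zero_of_notMem_tsupport fun h' => hx (hp.tsupport_subset
          (CartoonTV.tsupport_evalField_subset p _ h')), norm_zero]
        exact norm_nonneg w
  · -- a functional norming the jump turns almost optimal vector fields into admissible fields
    obtain ⟨q, hq1, hqw⟩ := exists_dual_vector'' ℝ w
    have hlim : Filter.Tendsto (fun δ : ℝ => ((‖w‖ * (h / (1 + δ)) : ℝ) : EReal)) (𝓝[>] 0)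
        (𝓝 ((‖w‖ * h : ℝ) : EReal)) := by
      have : ContinuousAt (fun δ : ℝ => ‖w‖ * (h / (1 + δ))) 0 :=
        continuousAt_const.mul (ContinuousAt.div (by fun_prop) (by fun_prop) (by simp))
      have := this.tendsto.mono_left (nhdsWithin_le_nhds (s := Set.Ioi 0))
      simp only [add_zero, div_one] at this
      exact (continuous_coe_real_ereal.tendsto _).comp this
    refine le_of_tendsto hlim ?_
    filter_upwards [self_mem_nhdsWithin] with δ hδ
    have hδ' : 0 < 1 + δ := by linarith [Set.mem_Ioi.1 hδ]
    obtain ⟨η, hη, hηc, hηΩ, hη1, hη0, -, hηh, -⟩ := hU.exists_almost_optimal_field hUm hK hΩ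
      (frontier_subset_closure.trans hUΩ.2) hδ
    set p : EuclideanSpace ℝ (Fin d) → Fin d → StrongDual ℝ V := fun x i => (-η x) i • q with hp
    have hpsupp : tsupport p ⊆ tsupport η := closure_mono fun x hx h0 => hx (by
      ext1 i; simp [hp, h0])
    have hpC : ContDiff ℝ 1 p :=
      contDiff_pi.2 fun i => (CartoonTV.contDiff_coord hη.neg i).smul contDiff_const
    have hadm : CartoonTV.IsAdmissible N Ω p :=
      ⟨hpC, hηc.of_isClosed_subset (isClosed_tsupport p) hpsupp, hpsupp.trans hηΩ, fun x _ =>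
        (hupper (-η x) q).trans (by
          rw [norm_neg]
          exact mul_le_one₀ (hη1 x) (norm_nonneg q) hq1)⟩
    refine le_iSup₂_of_le p hadm (EReal.coe_le_coe_iff.2 ?_)
    rw [CartoonTV.integral_divergence_apply_eq hUm hu_in hu_out hadm.contDiff
      hadm.hasCompactSupport hadm.tsupport_subset, ← integral_neg]
    have heval : ∀ x, -CartoonTV.scalarDivergence (CartoonTV.evalField p w) x =
        ‖w‖ * CartoonTV.scalarDivergence η x := fun x => by
      have : CartoonTV.evalField p w = fun x => (-‖w‖) • η x := by
        ext x i
        simp only [CartoonTV.evalField, hp, PiLp.neg_apply, PiLp.smul_apply, smul_eq_mul,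
          FunLike.coe_smul, Pi.smul_apply, hqw, RCLike.ofReal_real_eq_id, id_eq]
        ring
      rw [this, CartoonTV.scalarDivergence_const_smul _ hη]
      ring
    simp_rw [← hw, heval]
    rw [integral_const_mul]
    refine mul_le_mul_of_nonneg_left ?_ (norm_nonneg w)
    rw [div_le_iff₀' hδ']
    exact ENNReal.toReal_le_of_le_ofReal (mul_nonneg hδ'.le hη0) hηh
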